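/- Let $\bar L\in\mathbb C^{t\times p}$ have compact singular value decomposition $\bar L=\bar U\bar\Sigma\bar V^\dagger$ with $r$ positive singular values ($\bar U\in\mathbb C^{t\times r}$, $\bar V\in\mathbb C^{p\times r}$ with orthonormal columns). Let $W\in\mathbb C^{p\times n}$ have columns $W_j$ of Euclidean norm $1$, let $\bar C\in\mathbb C^{t\times n}$ have column support (set of indices of nonzero columns) $\bar{\mathcal I}$, and let $M=\bar L+\bar CW^T+N$ with $\|N\|_F\le\eta$. For a matrix $A$ let $\|A\|$, $\|A\|_F$, $\|A\|_*$ be its spectral, Frobenius and nuclear norm, $\|A\|_{1,2}$ the sum and $\|A\|_{\infty,2}$ the maximum of the Euclidean norms of its columns, $A^\dagger$ its conjugate transpose, $A^\ddagger$ its entrywise conjugate, and $A_{\mathcal I}$ its submatrix of columns with index in $\mathcal I$. Put $$\epsilon=\|\bar V^\dagger W^\ddagger\|_{\infty,2},\qquad \mu=\max_{i\ne j}|W_i^\dagger W_j|,\qquad \sigma_k=\max_{|\mathcal I|\le k}\|(W_{\mathcal I}^\dagger W_{\mathcal I})^{-1}\|$$ ($\mu=0$ if $n=1$). Let $\tilde\psi,c\in(0,1)$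 satisfy $(2-\tilde\psi)\sqrt{\tilde\psi}/(1-\tilde\psi)\le\sqrt{(1+c)/(1-c)}$, and for $k\ge1$ put $$\lambda'_{\min,k}=\frac{(1+(2-\tilde\psi)^{-1})\,\epsilon}{\frac12-(1+(2-\tilde\psi)^{-1})\,k\sigma_k\mu},\qquad \lambda'_{\max,k}=\frac12\sqrt{\frac{\tilde\psi}{k\sigma_k}} .$$ Suppose that an integer $\tilde k\ge1$ satisfies $\tilde k\mu\le c$, that the denominator of $\lambda'_{\min,\tilde k}$ is positive, and that $\lambda'_{\min,\tilde k}\le\lambda'_{\max,\tilde k}$. Let $k$ be an integer with $1\le k\le\tilde k$ and $|\bar{\mathcal I}|\le k$, let $\lambda\in[\lambda'_{\min,\tilde k},\lambda'_{\max,\tilde k}]$ with $\lambda>0$, and let $(L^*,C^*)$ be the output of Method 1 on the complete data $M$, that is, any optimal solution of $$\min_{L\in\mathbb C^{t\times p},\,C\in\mathbb C^{t\times n}}\ \|L\|_*+\lambda\|C\|_{1,2}\quad\text{subject to}\quad \|M-L-CW^T\|_F^2\le\eta^2 .$$ Then there is a pair $(\tilde L,\tilde C)$ with $\tilde L+\tilde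 CW^T=\bar L+\bar CW^T$, $\bar U\bar U^\dagger\tilde L=\tilde L$, and all columns of $\tilde C$ outside $\bar{\mathcal I}$ equal to zero, such that, with $\theta=\min(t,p)$, $$\|L^*-\tilde L\|_F\le\Big(2-\tilde\psi+\frac{\lambda+(2-\tilde\psi)\sqrt{1+(n-1)\mu}}{\lambda}\sqrt{\theta+3r}\Big)\frac{2\eta}{1-\tilde\psi},$$ $$\|C^*-\tilde C\|_F\le\Big(1+\Big(\frac{\lambda+\sqrt{1+(n-1)\mu}}{\lambda}+\frac{1-\tilde\psi}{\lambda\sigma_k\sqrt{1+(k-1)\mu}}\Big)\sqrt{\theta+3r}\Big)\frac{2\eta\,\sigma_k\sqrt{1+(k-1)\mu}}{1-\tilde\psi}.$$ -/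

import Mathlib

open scoped Matrix

noncomputable section

namespace AttackID

/-- The Frobenius norm of a complex matrix. -/
def frobeniusNorm {a b : Type*} [Fintype a] [Fintype b] (A : Matrix a b ℂ) : ℝ :=
  Real.sqrt (∑ i, ∑ j, ‖A i j‖ ^ 2)

/-- The spectral norm of a complex matrix: the operator norm between Euclidean spaces. -/
def spectralNorm {a b : Type*} [Fintype a] [Fintype b] [DecidableEq b] (A : Matrix a b ℂ) : ℝ :=
  @norm _ Matrix.instL2OpNormedAddCommGroup.toNorm A

/-- The nuclear norm: the sum of the singular values of `A`, that is, of the square roots of the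
eigenvalues (with multiplicity) of `Aᴴ * A`. -/
def nuclearNorm {a b : Type*} [Fintype a] [Fintype b] [DecidableEq b] (A : Matrix a b ℂ) : ℝ :=
  ∑ j, Real.sqrt ((Matrix.isHermitian_conjTranspose_mul_self A).eigenvalues j)

/-- The Euclidean norm of the `j`-th column. -/
def colNorm {a b : Type*} [Fintype a] (A : Matrix a b ℂ) (j : b) : ℝ :=
  Real.sqrt (∑ i, ‖A i j‖ ^ 2)

/-- `‖A‖_{1,2}`: the sum of the Euclidean norms of the columns. -/
def normOneTwo {a b : Type*} [Fintype a] [Fintype b] (A : Matrix a b ℂ) : ℝ :=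
  ∑ j, colNorm A j

/-- `‖A‖_{∞,2}`: the largest Euclidean norm of a column. -/
def normInftyTwo {a b : Type*} [Fintype a] (A : Matrix a b ℂ) : ℝ :=
  ⨆ j, colNorm A j

open Classical in
/-- The column support: the set of indices of nonzero columns. -/
def colSupport {a b : Type*} [Fintype b] (A : Matrix a b ℂ) : Finset b :=
  Finset.univ.filter fun j => ∃ i, A i j ≠ 0

/-- The submatrix of `A` formed by the columns with index in `I`. -/
def colSubmatrix {a b : Type*} (A : Matrix a b ℂ) (I : Finset b) : Matrix a I ℂ :=
  A.submatrix id (fun j : I => (j : b))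

/-- `P_U(A) = U Uᴴ A`. -/
def projU {a b c : Type*} [Fintype a] [Fintype c] (U : Matrix a c ℂ) (A : Matrix a b ℂ) :
    Matrix a b ℂ :=
  U * Uᴴ * A

open Classical in
/-- `P_I(A)`: the columns with index outside `I` are set to zero. -/
def projCols {a b : Type*} (I : Finset b) (A : Matrix a b ℂ) : Matrix a b ℂ :=
  Matrix.of fun i j => if j ∈ I then A i j else 0

/-- `ε = ‖V̄ᴴ W^‡‖_{∞,2}`, where `W^‡` is the entrywise complex conjugate of `W`. -/
def epsParam {p n r : ℕ} (V : Matrix (Fin p) (Fin r) ℂ) (W : Matrix (Fin p) (Fin n) ℂ) : ℝ :=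
  normInftyTwo (Vᴴ * W.map (starRingEnd ℂ))

/-- `μ = max_{i ≠ j} |W_iᴴ W_j|` (equal to `0` if there is only one column). -/
def muParam {p n : ℕ} (W : Matrix (Fin p) (Fin n) ℂ) : ℝ :=
  ⨆ q : {q : Fin n × Fin n // q.1 ≠ q.2}, ‖(Wᴴ * W) q.1.1 q.1.2‖

/-- `σ_k = max_{|I| ≤ k} ‖(W_Iᴴ W_I)⁻¹‖`. -/
def sigmaParam {p n : ℕ} (W : Matrix (Fin p) (Fin n) ℂ) (k : ℕ) : ℝ :=
  ⨆ I : {I : Finset (Fin n) // I.card ≤ k},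
    spectralNorm ((colSubmatrix W I.1)ᴴ * colSubmatrix W I.1)⁻¹

/-- The denominator of `λ'_{min,k}`: `1/2 - (1 + (2 - ψ)⁻¹) k σ_k μ`. -/
def lambdaMinDenom {p n : ℕ} (W : Matrix (Fin p) (Fin n) ℂ) (ψ : ℝ) (k : ℕ) : ℝ :=
  1 / 2 - (1 + (2 - ψ)⁻¹) * k * sigmaParam W k * muParam W

/-- `λ'_{min,k}`. -/
def lambdaMin {p n r : ℕ} (V : Matrix (Fin p) (Fin r) ℂ) (W : Matrix (Fin p) (Fin n) ℂ)
    (ψ : ℝ) (k : ℕ) : ℝ :=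
  (1 + (2 - ψ)⁻¹) * epsParam V W / lambdaMinDenom W ψ k

/-- `λ'_{max,k} = (1/2) √(ψ / (k σ_k))`. -/
def lambdaMax {p n : ℕ} (W : Matrix (Fin p) (Fin n) ℂ) (ψ : ℝ) (k : ℕ) : ℝ :=
  1 / 2 * Real.sqrt (ψ / (k * sigmaParam W k))

/-- A (compact) singular value decomposition `L = U Σ Vᴴ` of a matrix of rank `r`. -/
structure IsCompactSVD {t p r : ℕ} (L : Matrix (Fin t) (Fin p) ℂ) (U : Matrix (Fin t) (Fin r) ℂ)
    (s : Fin r → ℝ) (V : Matrix (Fin p) (Fin r) ℂ) : Prop where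
  orthonormal_left : Uᴴ * U = 1
  orthonormal_right : Vᴴ * V = 1
  pos : ∀ i, 0 < s i
  eq : L = U * Matrix.diagonal (fun i => (s i : ℂ)) * Vᴴ

/-- `(L, C)` is feasible for the convex program of Method 1 with complete measurements `M`. -/
def IsFeasible {t p n : ℕ} (M : Matrix (Fin t) (Fin p) ℂ) (W : Matrix (Fin p) (Fin n) ℂ) (η : ℝ)
    (L : Matrix (Fin t) (Fin p) ℂ) (C : Matrix (Fin t) (Fin n) ℂ) : Prop :=
  ∑ i, ∑ j, ‖(M - L - C * Wᵀ) i j‖ ^ 2 ≤ η ^ 2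

/-- `(L, C)` is an output of Method 1 with complete measurements `M`: an optimal solution of
`min ‖L‖_* + lam ‖C‖_{1,2}` subject to `‖M - L - C Wᵀ‖_F² ≤ η²`. -/
def IsMethodOutput {t p n : ℕ} (M : Matrix (Fin t) (Fin p) ℂ) (W : Matrix (Fin p) (Fin n) ℂ)
    (η lam : ℝ) (L : Matrix (Fin t) (Fin p) ℂ) (C : Matrix (Fin t) (Fin n) ℂ) : Prop :=
  IsFeasible M W η L C ∧
    ∀ (L' : Matrix (Fin t) (Fin p) ℂ) (C' : Matrix (Fin t) (Fin n) ℂ), IsFeasible M W η L' C' →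
      nuclearNorm L + lam * normOneTwo C ≤ nuclearNorm L' + lam * normOneTwo C'

end AttackID

end

noncomputable section

namespace AttackID

/-! Write `w` for the conjugated columns of `W` on the support and `w'` for those off it, so that `C
Wᵀ` becomes `C₁ wᴴ + C₂ w'ᴴ`. A matrix `U B` can be moved from the sparse to the low-rank part
without changing the signal, so the original pair need not be the right point of comparison. The
proof uses instead an oracle pair `(L₁, C')`, the cheapest for the objective among all `(L₀ - U B
wᴴ, C₀ + U B)`. Hahn-Banach supplies dual variables `G`, `S` at this pair with `Uᴴ G w = Uᴴ S`
(`exists_oracle_solution`).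

Put `E = Uᴴ G`. Equality in the duality of nuclear and spectral norm makes `E` a polar factor of `Uᴴ
L₁` (`polar_of_reInner_eq_nuclearNorm`). Since the range of `V` is almost orthogonal to that of `w`,
the matrix `Uᴴ L₁` is onto and `E` is a coisometry (`polar_factor_properties`); thus `U E` plays for
`L₁` the part that `U Vᴴ` plays for the original matrix. A least-norm correction `Q`, orthogonal to
the tangent space `{U X + Y E}`, makes `(U E + Q) w = S` (`exists_certificate`). This certificate
has slack `1/2` orthogonally to the tangent space and `l/2` on the columns of `w'`
(`euclNorm_certificate_le`).

Optimality and the two slacks bound the normal component `D` of the error in `L` and the off-support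
part `C₂` by twice the Frobenius norm of `U E + Q`, at most `√(θ + 3r)`, times the residual, at most
`2η` (`error_le_of_certificate`, `frobeniusNorm_certificate_sq_le`). What is left lies in the
tangent space and on the support. The part `U Uᴴ C` of the error `C` on the support is absorbed into
the pair `(L̃, C̃)`; the rest, `T`, satisfies that `T wᴴ` has only a small component along `E`, so a
tangent error cannot cancel it (`tangent_error_bound`). `exists_recovery` combines these bounds. -/

/-- The Euclidean norm of a complex vector. -/
def euclNorm {ι : Type*} [Fintype ι] (x : ι → ℂ) : ℝ := Real.sqrt (∑ i, ‖x i‖ ^ 2)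

/-- The real part of the inner product of two complex vectors. -/
def reDot {ι : Type*} [Fintype ι] (x y : ι → ℂ) : ℝ := (star x ⬝ᵥ y).re

/-- The real part of the Frobenius inner product of two complex matrices. -/
def reInner {a b : Type*} [Fintype a] [Fintype b] (A B : Matrix a b ℂ) : ℝ := (Aᴴ * B).trace.re

/-- `c` bounds the operator norm of `A` between Euclidean spaces. -/
def OpBound {a b : Type*} [Fintype a] [Fintype b] (A : Matrix a b ℂ) (c : ℝ) : Prop :=
  ∀ x, euclNorm (A *ᵥ x) ≤ c * euclNorm x

/-! ### Euclidean norm and real inner product of complex vectors -/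

section Vectors

variable {ι : Type*} [Fintype ι]

lemma euclNorm_eq_norm (x : ι → ℂ) : euclNorm x = ‖(WithLp.toLp 2 x : EuclideanSpace ℂ ι)‖ := by
  rw [EuclideanSpace.norm_eq]; rfl

lemma reDot_eq_inner (x y : ι → ℂ) :
    reDot x y = RCLike.re (inner ℂ (WithLp.toLp 2 x : EuclideanSpace ℂ ι) (WithLp.toLp 2 y)) := by
  rw [EuclideanSpace.inner_eq_star_dotProduct]
  simp [reDot, dotProduct_comm]

lemma euclNorm_nonneg (x : ι → ℂ) : 0 ≤ euclNorm x := Real.sqrt_nonneg _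

lemma euclNorm_sq (x : ι → ℂ) : euclNorm x ^ 2 = ∑ i, ‖x i‖ ^ 2 :=
  Real.sq_sqrt (by positivity)

lemma reDot_self (x : ι → ℂ) : reDot x x = euclNorm x ^ 2 := by
  rw [reDot_eq_inner, euclNorm_eq_norm, inner_self_eq_norm_sq]

lemma reDot_le (x y : ι → ℂ) : reDot x y ≤ euclNorm x * euclNorm y := by
  rw [reDot_eq_inner, euclNorm_eq_norm, euclNorm_eq_norm]
  exact re_inner_le_norm _ _

lemma reDot_comm (x y : ι → ℂ) : reDot x y = reDot y x := by
  rw [reDot_eq_inner, reDot_eq_inner]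
  exact inner_re_symm _ _

lemma reDot_add_right (x y z : ι → ℂ) : reDot x (y + z) = reDot x y + reDot x z := by
  simp [reDot]

lemma reDot_add_left (x y z : ι → ℂ) : reDot (x + y) z = reDot x z + reDot y z := by
  simp [reDot]

lemma reDot_sub_right (x y z : ι → ℂ) : reDot x (y - z) = reDot x y - reDot x z := by
  simp [reDot]

lemma reDot_sub_left (x y z : ι → ℂ) : reDot (x - y) z = reDot x z - reDot y z := by
  simp [reDot]

lemma reDot_neg_right (x y : ι → ℂ) : reDot x (-y) = -reDot x y := by
  simp [reDot]

lemma reDot_zero_right (x : ι → ℂ) : reDot x 0 = 0 := by simp [reDot]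

lemma reDot_zero_left (x : ι → ℂ) : reDot 0 x = 0 := by simp [reDot]

lemma reDot_real_smul_right (c : ℝ) (x y : ι → ℂ) : reDot x ((c : ℂ) • y) = c * reDot x y := by
  simp [reDot]

lemma euclNorm_zero : euclNorm (0 : ι → ℂ) = 0 := by simp [euclNorm]

lemma euclNorm_neg (x : ι → ℂ) : euclNorm (-x) = euclNorm x := by simp [euclNorm]

lemma euclNorm_eq_zero {x : ι → ℂ} : euclNorm x = 0 ↔ x = 0 := by
  rw [euclNorm_eq_norm, norm_eq_zero]
  exact ⟨fun h => by simpa using congrArg WithLp.ofLp h, fun h => by simp [h]⟩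

lemma euclNorm_add_le (x y : ι → ℂ) : euclNorm (x + y) ≤ euclNorm x + euclNorm y := by
  simp only [euclNorm_eq_norm, WithLp.toLp_add]
  exact norm_add_le _ _

lemma euclNorm_sub_le (x y : ι → ℂ) : euclNorm (x - y) ≤ euclNorm x + euclNorm y := by
  simpa [sub_eq_add_neg, euclNorm_neg] using euclNorm_add_le x (-y)

lemma euclNorm_real_smul (c : ℝ) (x : ι → ℂ) : euclNorm ((c : ℂ) • x) = |c| * euclNorm x := by
  simp only [euclNorm_eq_norm, WithLp.toLp_smul, norm_smul, Complex.norm_real, Real.norm_eq_abs]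

lemma euclNorm_sub_sq (x y : ι → ℂ) :
    euclNorm (x - y) ^ 2 = euclNorm x ^ 2 - 2 * reDot x y + euclNorm y ^ 2 := by
  rw [← reDot_self, reDot_sub_left, reDot_sub_right, reDot_sub_right, reDot_self, reDot_self,
    reDot_comm y x]
  ring

lemma euclNorm_add_sq (x y : ι → ℂ) :
    euclNorm (x + y) ^ 2 = euclNorm x ^ 2 + 2 * reDot x y + euclNorm y ^ 2 := by
  rw [← reDot_self, reDot_add_left, reDot_add_right, reDot_add_right, reDot_self, reDot_self,
    reDot_comm y x]
  ring

lemma euclNorm_le_of_sq_le {x : ι → ℂ} {c : ℝ} (hc : 0 ≤ c) (h : euclNorm x ^ 2 ≤ c * euclNorm x) :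
    euclNorm x ≤ c := by
  rcases (euclNorm_nonneg x).eq_or_lt with h0 | h0
  · rwa [← h0]
  · nlinarith

lemma euclNorm_le_sqrt_card {x : ι → ℂ} {c : ℝ} (hc : 0 ≤ c) (h : ∀ i, ‖x i‖ ≤ c) :
    euclNorm x ≤ Real.sqrt (Fintype.card ι) * c := by
  apply Real.sqrt_le_iff.mpr ⟨by positivity, ?_⟩
  rw [mul_pow, Real.sq_sqrt (by positivity)]
  calc ∑ i, ‖x i‖ ^ 2 ≤ ∑ _i : ι, c ^ 2 :=
        Finset.sum_le_sum fun i _ => pow_le_pow_left₀ (norm_nonneg _) (h i) 2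
    _ = _ := by simp

end Vectors

/-! ### Operator bounds and the Frobenius inner product -/

section Matrices

variable {a b c d : Type*} [Fintype a] [Fintype b] [Fintype c] [Fintype d]

lemma reDot_mulVec (A : Matrix a b ℂ) (x : b → ℂ) (y : a → ℂ) :
    reDot (A *ᵥ x) y = reDot x (Aᴴ *ᵥ y) := by
  rw [reDot, reDot, Matrix.star_mulVec, Matrix.dotProduct_mulVec]

lemma reDot_mulVec' (A : Matrix a b ℂ) (x : a → ℂ) (y : b → ℂ) :
    reDot x (A *ᵥ y) = reDot (Aᴴ *ᵥ x) y := by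
  rw [reDot_mulVec, Matrix.conjTranspose_conjTranspose]

lemma euclNorm_mulVec_sq (A : Matrix a b ℂ) (x : b → ℂ) :
    euclNorm (A *ᵥ x) ^ 2 = reDot x ((Aᴴ * A) *ᵥ x) := by
  rw [← reDot_self, reDot_mulVec, Matrix.mulVec_mulVec]

lemma euclNorm_mulVec_of_isometry [DecidableEq b] {A : Matrix a b ℂ} (hA : Aᴴ * A = 1)
    (x : b → ℂ) : euclNorm (A *ᵥ x) = euclNorm x := by
  have h := euclNorm_mulVec_sq A x
  rw [hA, Matrix.one_mulVec, reDot_self] at h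
  exact (pow_left_inj₀ (euclNorm_nonneg _) (euclNorm_nonneg _) two_ne_zero).mp h

lemma OpBound.conjTranspose {A : Matrix a b ℂ} {k : ℝ} (hk : 0 ≤ k) (h : OpBound A k) :
    OpBound Aᴴ k := by
  intro x
  apply euclNorm_le_of_sq_le (by have := euclNorm_nonneg x; positivity)
  rw [← reDot_self, ← reDot_mulVec']
  calc _ ≤ euclNorm x * euclNorm (A *ᵥ Aᴴ *ᵥ x) := reDot_le _ _
    _ ≤ euclNorm x * (k * euclNorm (Aᴴ *ᵥ x)) :=
      mul_le_mul_of_nonneg_left (h _) (euclNorm_nonneg _)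
    _ = _ := by ring

lemma OpBound.of_isometry [DecidableEq b] {A : Matrix a b ℂ} (hA : Aᴴ * A = 1) : OpBound A 1 :=
  fun x => by rw [euclNorm_mulVec_of_isometry hA, one_mul]

lemma OpBound.mul {A : Matrix a b ℂ} {B : Matrix b c ℂ} {k l : ℝ} (hk : 0 ≤ k) (hA : OpBound A k)
    (hB : OpBound B l) : OpBound (A * B) (k * l) := by
  intro x
  rw [← Matrix.mulVec_mulVec, mul_assoc]
  exact (hA _).trans (mul_le_mul_of_nonneg_left (hB x) hk)

lemma OpBound.add {A B : Matrix a b ℂ} {k l : ℝ} (hA : OpBound A k)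
    (hB : OpBound B l) : OpBound (A + B) (k + l) := by
  intro x
  rw [Matrix.add_mulVec, add_mul]
  exact (euclNorm_add_le _ _).trans (add_le_add (hA x) (hB x))

lemma trace_conjTranspose_mul (A B : Matrix a b ℂ) :
    (Aᴴ * B).trace = ∑ j, star (A.col j) ⬝ᵥ B.col j := by
  simp [Matrix.trace, Matrix.mul_apply, dotProduct]

lemma reInner_eq_sum (A B : Matrix a b ℂ) : reInner A B = ∑ j, reDot (A.col j) (B.col j) := by
  rw [reInner, trace_conjTranspose_mul, Complex.re_sum]; rfl

lemma reInner_eq_reDot (A B : Matrix a b ℂ) :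
    reInner A B = reDot (fun q : a × b => A q.1 q.2) (fun q => B q.1 q.2) := by
  simp only [reInner_eq_sum, reDot, dotProduct, Complex.re_sum]
  rw [Fintype.sum_prod_type_right]
  rfl

lemma frobeniusNorm_eq_euclNorm (A : Matrix a b ℂ) :
    frobeniusNorm A = euclNorm (fun q : a × b => A q.1 q.2) := by
  rw [frobeniusNorm, euclNorm, Fintype.sum_prod_type]

lemma frobeniusNorm_nonneg (A : Matrix a b ℂ) : 0 ≤ frobeniusNorm A := Real.sqrt_nonneg _

lemma reInner_self (A : Matrix a b ℂ) : reInner A A = frobeniusNorm A ^ 2 := by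
  rw [reInner_eq_reDot, frobeniusNorm_eq_euclNorm, reDot_self]

lemma reInner_le (A B : Matrix a b ℂ) : reInner A B ≤ frobeniusNorm A * frobeniusNorm B := by
  rw [reInner_eq_reDot, frobeniusNorm_eq_euclNorm, frobeniusNorm_eq_euclNorm]
  exact reDot_le _ _

lemma reInner_add_left (A B C : Matrix a b ℂ) : reInner (A + B) C = reInner A C + reInner B C := by
  simp [reInner, Matrix.add_mul]

lemma reInner_add_right (A B C : Matrix a b ℂ) : reInner A (B + C) = reInner A B + reInner A C := by
  simp [reInner, Matrix.mul_add]

lemma reInner_sub_left (A B C : Matrix a b ℂ) : reInner (A - B) C = reInner A C - reInner B C := by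
  simp [reInner, Matrix.sub_mul]

lemma reInner_sub_right (A B C : Matrix a b ℂ) : reInner A (B - C) = reInner A B - reInner A C := by
  simp [reInner, Matrix.mul_sub]

lemma reInner_neg_right (A B : Matrix a b ℂ) : reInner A (-B) = -reInner A B := by
  simp [reInner]

lemma reInner_zero_left (A : Matrix a b ℂ) : reInner 0 A = 0 := by simp [reInner]

lemma reInner_zero_right (A : Matrix a b ℂ) : reInner A 0 = 0 := by simp [reInner]

lemma reInner_smul_right (r : ℝ) (A B : Matrix a b ℂ) :
    reInner A (r • B) = r * reInner A B := by
  simp [reInner]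

lemma reInner_smul_left (r : ℝ) (A B : Matrix a b ℂ) :
    reInner (r • A) B = r * reInner A B := by
  simp [reInner, Matrix.conjTranspose_smul]

lemma reInner_comm (A B : Matrix a b ℂ) : reInner A B = reInner B A := by
  rw [reInner_eq_reDot, reInner_eq_reDot, reDot_comm]

lemma reInner_mul_left (A : Matrix a b ℂ) (B : Matrix b c ℂ) (C : Matrix a c ℂ) :
    reInner (A * B) C = reInner B (Aᴴ * C) := by
  simp [reInner, Matrix.conjTranspose_mul, Matrix.mul_assoc]

lemma reInner_mul_right (A : Matrix a b ℂ) (B : Matrix b c ℂ) (C : Matrix a c ℂ) :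
    reInner (A * B) C = reInner A (C * Bᴴ) := by
  rw [reInner, reInner, Matrix.conjTranspose_mul, Matrix.mul_assoc, Matrix.trace_mul_comm,
    Matrix.mul_assoc]

lemma frobeniusNorm_conjTranspose (A : Matrix a b ℂ) : frobeniusNorm Aᴴ = frobeniusNorm A := by
  rw [frobeniusNorm, frobeniusNorm, Finset.sum_comm]
  simp

lemma frobeniusNorm_add_le (A B : Matrix a b ℂ) :
    frobeniusNorm (A + B) ≤ frobeniusNorm A + frobeniusNorm B := by
  simp only [frobeniusNorm_eq_euclNorm]
  exact euclNorm_add_le _ _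

lemma frobeniusNorm_neg (A : Matrix a b ℂ) : frobeniusNorm (-A) = frobeniusNorm A := by
  simp [frobeniusNorm]

lemma frobeniusNorm_sub_le (A B : Matrix a b ℂ) :
    frobeniusNorm (A - B) ≤ frobeniusNorm A + frobeniusNorm B := by
  simpa [sub_eq_add_neg, frobeniusNorm_neg] using frobeniusNorm_add_le A (-B)

lemma frobeniusNorm_eq_zero {A : Matrix a b ℂ} : frobeniusNorm A = 0 ↔ A = 0 := by
  rw [frobeniusNorm_eq_euclNorm, euclNorm_eq_zero]
  exact ⟨fun h => Matrix.ext fun i j => congrFun h (i, j), fun h => by simp [h]; rfl⟩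

lemma frobeniusNorm_sq_cols (A : Matrix a b ℂ) :
    frobeniusNorm A ^ 2 = ∑ j, euclNorm (A.col j) ^ 2 := by
  rw [← reInner_self, reInner_eq_sum]
  simp only [reDot_self]

omit [Fintype a] [Fintype c] in
lemma col_mul (A : Matrix a b ℂ) (B : Matrix b c ℂ) (j : c) : (A * B).col j = A *ᵥ B.col j := rfl

lemma euclNorm_col_le (A : Matrix a b ℂ) (j : b) : euclNorm (A.col j) ≤ frobeniusNorm A := by
  apply abs_le_of_sq_le_sq' _ (frobeniusNorm_nonneg A) |>.2
  rw [frobeniusNorm_sq_cols]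
  exact Finset.single_le_sum (f := fun j => euclNorm (A.col j) ^ 2)
    (fun _ _ => by positivity) (Finset.mem_univ j)

lemma frobeniusNorm_mul_le_left {A : Matrix a b ℂ} {k : ℝ} (hk : 0 ≤ k) (hA : OpBound A k)
    (B : Matrix b c ℂ) : frobeniusNorm (A * B) ≤ k * frobeniusNorm B := by
  refine abs_le_of_sq_le_sq' ?_ (mul_nonneg hk (frobeniusNorm_nonneg B)) |>.2
  rw [mul_pow, frobeniusNorm_sq_cols, frobeniusNorm_sq_cols, Finset.mul_sum]
  refine Finset.sum_le_sum fun j _ => ?_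
  rw [← mul_pow, col_mul]
  exact pow_le_pow_left₀ (euclNorm_nonneg _) (hA _) 2

lemma frobeniusNorm_mul_le_right {B : Matrix b c ℂ} {k : ℝ} (hk : 0 ≤ k) (hB : OpBound B k)
    (A : Matrix a b ℂ) : frobeniusNorm (A * B) ≤ k * frobeniusNorm A := by
  rw [← frobeniusNorm_conjTranspose, Matrix.conjTranspose_mul, ← frobeniusNorm_conjTranspose A]
  exact frobeniusNorm_mul_le_left hk (hB.conjTranspose hk) _

/-- A lower bound for `B` on vectors gives one for right multiplication by `Bᴴ`. -/
lemma frobeniusNorm_sq_le_mul_conjTranspose {B : Matrix b c ℂ} {k : ℝ}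
    (hB : ∀ x, euclNorm x ^ 2 ≤ k * euclNorm (B *ᵥ x) ^ 2) (A : Matrix a c ℂ) :
    frobeniusNorm A ^ 2 ≤ k * frobeniusNorm (A * Bᴴ) ^ 2 := by
  rw [← frobeniusNorm_conjTranspose, ← frobeniusNorm_conjTranspose (A * Bᴴ),
    Matrix.conjTranspose_mul, Matrix.conjTranspose_conjTranspose, frobeniusNorm_sq_cols,
    frobeniusNorm_sq_cols, Finset.mul_sum]
  exact Finset.sum_le_sum fun j _ => hB _

/-- The vector `x`, read as a one-column matrix, is an operator of norm `euclNorm x`, so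
submultiplicativity of the Frobenius norm applies to the product. -/
lemma OpBound.frobenius (A : Matrix a b ℂ) : OpBound A (frobeniusNorm A) := by
  intro x
  have h := frobeniusNorm_mul_le_right (B := Matrix.replicateCol Unit x) (k := euclNorm x)
    (euclNorm_nonneg x) (fun y => ?_) A
  · refine le_trans ?_ (h.trans_eq (mul_comm _ _))
    exact euclNorm_col_le (A * Matrix.replicateCol Unit x) ()
  · have : Matrix.replicateCol Unit x *ᵥ y = fun i => x i * y () := by
      ext i; simp [Matrix.mulVec, dotProduct]
    rw [this]
    simp only [euclNorm, norm_mul, mul_pow, ← Finset.sum_mul]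
    rw [Real.sqrt_mul (by positivity)]
    simp

lemma frobeniusNorm_le_of_cols {A : Matrix a b ℂ} {k : ℝ} (hk : 0 ≤ k)
    (h : ∀ j, euclNorm (A.col j) ≤ k) :
    frobeniusNorm A ≤ Real.sqrt (Fintype.card b) * k := by
  refine abs_le_of_sq_le_sq' ?_ (by positivity) |>.2
  rw [mul_pow, Real.sq_sqrt (by positivity), frobeniusNorm_sq_cols]
  calc _ ≤ ∑ _j : b, k ^ 2 :=
        Finset.sum_le_sum fun i _ => pow_le_pow_left₀ (euclNorm_nonneg _) (h i) 2
    _ = _ := by simp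

lemma frobeniusNorm_le_normOneTwo (A : Matrix a b ℂ) : frobeniusNorm A ≤ normOneTwo A := by
  have h0 : ∀ j ∈ Finset.univ, 0 ≤ colNorm A j := fun j _ => Real.sqrt_nonneg _
  refine abs_le_of_sq_le_sq' ?_ (Finset.sum_nonneg h0) |>.2
  rw [frobeniusNorm_sq_cols]
  exact Finset.sum_sq_le_sq_sum_of_nonneg h0

/-- The Gram matrix of a family that is bounded below is invertible. -/
lemma exists_gram_inv [DecidableEq b] {A : Matrix a b ℂ} (hA : ∀ x, A *ᵥ x = 0 → x = 0) :
    ∃ J : Matrix b b ℂ, J * (Aᴴ * A) = 1 ∧ (Aᴴ * A) * J = 1 := by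
  have hinj : Function.Injective (Aᴴ * A).mulVec := by
    intro x y hxy
    have h : (Aᴴ * A) *ᵥ (x - y) = 0 := by rw [Matrix.mulVec_sub, sub_eq_zero]; exact hxy
    have h2 := euclNorm_mulVec_sq A (x - y)
    rw [h, reDot_zero_right] at h2
    exact sub_eq_zero.mp (hA _ (euclNorm_eq_zero.mp (by simpa using h2)))
  have hu := Matrix.mulVec_injective_iff_isUnit.mp hinj
  exact ⟨(Aᴴ * A)⁻¹, Matrix.nonsing_inv_mul _ ((Matrix.isUnit_iff_isUnit_det _).mp hu),
    Matrix.mul_nonsing_inv _ ((Matrix.isUnit_iff_isUnit_det _).mp hu)⟩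

end Matrices

/-! ### The nuclear norm and its duality with the spectral norm -/

section Nuclear

variable {a b c : Type*} [Fintype a] [Fintype b] [Fintype c] [DecidableEq b]

open scoped ComplexOrder in
/-- A right singular basis: a unitary `U` such that the columns of `A * U` are orthogonal, with the
singular values as their norms. -/
lemma exists_singular_basis (A : Matrix a b ℂ) :
    ∃ (U : Matrix b b ℂ) (s : b → ℝ), Uᴴ * U = 1 ∧ U * Uᴴ = 1 ∧ (∀ j, 0 ≤ s j) ∧
      (A * U)ᴴ * (A * U) = Matrix.diagonal (fun j => ((s j ^ 2 : ℝ) : ℂ)) ∧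
      nuclearNorm A = ∑ j, s j := by
  have hH := Matrix.isHermitian_conjTranspose_mul_self A
  set U : Matrix b b ℂ := (hH.eigenvectorUnitary : Matrix b b ℂ) with hU
  have h1 : Uᴴ * U = 1 := Unitary.coe_star_mul_self hH.eigenvectorUnitary
  have h2 : U * Uᴴ = 1 := Unitary.coe_mul_star_self hH.eigenvectorUnitary
  have h3 : Uᴴ * (Aᴴ * A) * U = Matrix.diagonal (fun j => (hH.eigenvalues j : ℂ)) := by
    have h := hH.conjStarAlgAut_star_eigenvectorUnitary
    rw [Unitary.conjStarAlgAut_star_apply] at h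
    exact h
  have hpos : ∀ j, 0 ≤ hH.eigenvalues j :=
    (Matrix.posSemidef_conjTranspose_mul_self A).eigenvalues_nonneg
  refine ⟨U, fun j => Real.sqrt (hH.eigenvalues j), h1, h2, fun j => Real.sqrt_nonneg _, ?_, rfl⟩
  simp only [Real.sq_sqrt (hpos _)]
  rw [← h3, Matrix.conjTranspose_mul]
  simp only [Matrix.mul_assoc]

lemma reInner_eq_sum_basis {U : Matrix b b ℂ} (hU : U * Uᴴ = 1) (F A : Matrix a b ℂ) :
    reInner F A = ∑ j, reDot ((F * U).col j) ((A * U).col j) := by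
  rw [← reInner_eq_sum, reInner_mul_right, Matrix.mul_assoc, hU, Matrix.mul_one]

omit [Fintype b] in
lemma euclNorm_col_of_gram {T : Matrix a b ℂ} {s : b → ℝ} (hs : ∀ j, 0 ≤ s j)
    (hT : Tᴴ * T = Matrix.diagonal (fun j => ((s j ^ 2 : ℝ) : ℂ))) (j : b) :
    euclNorm (T.col j) = s j := by
  have h : ((Tᴴ * T) j j).re = euclNorm (T.col j) ^ 2 := by
    rw [← reDot_self]; rfl
  rw [hT, Matrix.diagonal_apply_eq, Complex.ofReal_re] at h
  exact ((pow_left_inj₀ (hs j) (euclNorm_nonneg _) two_ne_zero).mp h).symm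

omit [Fintype b] in
lemma euclNorm_col_of_isometry {U : Matrix c b ℂ} (hU : Uᴴ * U = 1) (j : b) :
    euclNorm (U.col j) = 1 := by
  apply euclNorm_col_of_gram (s := fun _ => 1) (fun _ => zero_le_one)
  rw [hU]; simp

/-- In a right singular basis of `A` the pairing splits into columns, and Cauchy-Schwarz bounds each
term by one singular value. -/
lemma reInner_le_nuclearNorm {F : Matrix a b ℂ} (hF : OpBound F 1) (A : Matrix a b ℂ) :
    reInner F A ≤ nuclearNorm A := by
  obtain ⟨U, s, h1, h2, hs, hd, hn⟩ := exists_singular_basis A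
  rw [reInner_eq_sum_basis h2, hn]
  refine Finset.sum_le_sum fun j _ => (reDot_le _ _).trans ?_
  rw [euclNorm_col_of_gram hs hd, col_mul]
  have := hF (U.col j)
  rw [euclNorm_col_of_isometry h1, mul_one] at this
  nlinarith [hs j]

/-- The partial isometry of the polar decomposition attains the bound. With the previous lemma the
nuclear norm is a maximum of linear functionals, from which its norm properties follow. -/
lemma exists_reInner_eq_nuclearNorm (A : Matrix a b ℂ) :
    ∃ F : Matrix a b ℂ, OpBound F 1 ∧ reInner F A = nuclearNorm A := by
  obtain ⟨U, s, h1, h2, hs, hd, hn⟩ := exists_singular_basis A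
  -- Since `0⁻¹ = 0`, this is the pseudo-inverse of the singular values, and `A * U * D` has columns
  -- of norm `1` or `0`.
  set D : Matrix b b ℂ := Matrix.diagonal (fun j => (((s j)⁻¹ : ℝ) : ℂ)) with hD
  have hDH : Dᴴ = D := by
    rw [hD, Matrix.diagonal_conjTranspose]
    congr 1; ext j; simp
  have key : ((A * U) * D)ᴴ * ((A * U) * D) =
      Matrix.diagonal (fun j => (((s j)⁻¹ * s j ^ 2 * (s j)⁻¹ : ℝ) : ℂ)) := by
    rw [Matrix.conjTranspose_mul, hDH, Matrix.mul_assoc, ← Matrix.mul_assoc (A * U)ᴴ, hd, hD,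
      Matrix.diagonal_mul_diagonal, Matrix.diagonal_mul_diagonal]
    congr 1; ext j; push_cast; ring
  have hle : ∀ j, (s j)⁻¹ * s j ^ 2 * (s j)⁻¹ ≤ 1 := by
    intro j
    rcases eq_or_ne (s j) 0 with h | h
    · simp [h]
    · apply le_of_eq; field_simp
  have hb : OpBound ((A * U) * D) 1 := by
    intro x
    rw [one_mul]
    refine abs_le_of_sq_le_sq' ?_ (euclNorm_nonneg x) |>.2
    rw [euclNorm_mulVec_sq, key, euclNorm_sq, reDot, dotProduct, Complex.re_sum]
    refine Finset.sum_le_sum fun j _ => ?_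
    have : (star x j * ((Matrix.diagonal fun j => (((s j)⁻¹ * s j ^ 2 * (s j)⁻¹ : ℝ) : ℂ)) *ᵥ x) j)
        = (((s j)⁻¹ * s j ^ 2 * (s j)⁻¹ * ‖x j‖ ^ 2 : ℝ) : ℂ) := by
      rw [Matrix.mulVec_diagonal, Complex.ofReal_mul _ (‖x j‖ ^ 2), Complex.ofReal_pow,
        ← Complex.conj_mul']
      simp only [Pi.star_apply, RCLike.star_def]
      ring
    rw [this, Complex.ofReal_re]
    exact mul_le_of_le_one_left (by positivity) (hle j)
  refine ⟨(A * U) * D * Uᴴ, ?_, ?_⟩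
  · have hU : OpBound Uᴴ 1 := .of_isometry (by rwa [Matrix.conjTranspose_conjTranspose])
    simpa using hb.mul zero_le_one hU
  · rw [reInner_mul_right, Matrix.conjTranspose_conjTranspose, reInner, Matrix.conjTranspose_mul,
      Matrix.mul_assoc, hd, hDH, hD, Matrix.diagonal_mul_diagonal, Matrix.trace_diagonal, hn,
      Complex.re_sum]
    refine Finset.sum_congr rfl fun j _ => ?_
    rw [← Complex.ofReal_mul, Complex.ofReal_re]
    rcases eq_or_ne (s j) 0 with h | h
    · simp [h]
    · field_simp

lemma nuclearNorm_nonneg (A : Matrix a b ℂ) : 0 ≤ nuclearNorm A :=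
  Finset.sum_nonneg fun _ _ => Real.sqrt_nonneg _

lemma nuclearNorm_zero : nuclearNorm (0 : Matrix a b ℂ) = 0 := by
  obtain ⟨F, -, h⟩ := exists_reInner_eq_nuclearNorm (0 : Matrix a b ℂ)
  rw [← h, reInner_zero_right]

lemma nuclearNorm_add_le (A B : Matrix a b ℂ) :
    nuclearNorm (A + B) ≤ nuclearNorm A + nuclearNorm B := by
  obtain ⟨F, hF, h⟩ := exists_reInner_eq_nuclearNorm (A + B)
  rw [← h, reInner_add_right]
  exact add_le_add (reInner_le_nuclearNorm hF A) (reInner_le_nuclearNorm hF B)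

lemma nuclearNorm_smul_le {r : ℝ} (hr : 0 ≤ r) (A : Matrix a b ℂ) :
    nuclearNorm (r • A) ≤ r * nuclearNorm A := by
  obtain ⟨F, hF, h⟩ := exists_reInner_eq_nuclearNorm (r • A)
  rw [← h, reInner_smul_right]
  exact mul_le_mul_of_nonneg_left (reInner_le_nuclearNorm hF A) hr

lemma nuclearNorm_smul {r : ℝ} (hr : 0 ≤ r) (A : Matrix a b ℂ) :
    nuclearNorm (r • A) = r * nuclearNorm A := by
  refine le_antisymm (nuclearNorm_smul_le hr A) ?_
  obtain ⟨F, hF, h⟩ := exists_reInner_eq_nuclearNorm A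
  rw [← h, ← reInner_smul_right]
  exact reInner_le_nuclearNorm hF _

lemma frobeniusNorm_sq_of_isometry {V : Matrix a b ℂ} (hV : Vᴴ * V = 1) :
    frobeniusNorm V ^ 2 = Fintype.card b := by
  rw [← reInner_self, reInner, hV]; simp

lemma nuclearNorm_le_frobeniusNorm (A : Matrix a b ℂ) :
    nuclearNorm A ≤ Real.sqrt (Fintype.card b) * frobeniusNorm A := by
  obtain ⟨F, hF, h⟩ := exists_reInner_eq_nuclearNorm A
  rw [← h]
  refine (reInner_le F A).trans (mul_le_mul_of_nonneg_right ?_ (frobeniusNorm_nonneg A))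
  have h1 := frobeniusNorm_mul_le_left zero_le_one hF (1 : Matrix b b ℂ)
  have h2 := frobeniusNorm_sq_of_isometry (V := (1 : Matrix b b ℂ)) (by simp)
  rw [Matrix.mul_one, one_mul] at h1
  exact h1.trans (Real.le_sqrt_of_sq_le h2.le)

omit [DecidableEq b] in
lemma reInner_vecMulVec (F : Matrix a b ℂ) (y : a → ℂ) (x : b → ℂ) :
    reInner F (Matrix.vecMulVec y (star x)) = reDot (F *ᵥ x) y := by
  rw [reInner, Matrix.mul_vecMulVec, Matrix.trace_vecMulVec, dotProduct_comm, reDot_mulVec]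
  rfl

/-- The dual norm of the nuclear norm is the spectral norm. -/
lemma opBound_of_reInner_le_nuclearNorm {G : Matrix a b ℂ}
    (hG : ∀ L, reInner G L ≤ nuclearNorm L) : OpBound G 1 := by
  intro x
  have h := hG (Matrix.vecMulVec (G *ᵥ x) (star x))
  obtain ⟨F, hF, hn⟩ := exists_reInner_eq_nuclearNorm (Matrix.vecMulVec (G *ᵥ x) (star x))
  rw [← hn, reInner_vecMulVec, reInner_vecMulVec, reDot_self] at h
  rw [one_mul]
  apply euclNorm_le_of_sq_le (euclNorm_nonneg x)
  refine h.trans ((reDot_le _ _).trans ?_)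
  have := hF x
  rw [one_mul] at this
  exact mul_le_mul_of_nonneg_right this (euclNorm_nonneg _)

omit [Fintype a] in
lemma eq_mul_diagonal_of_col {X Y : Matrix a b ℂ} {s : b → ℂ}
    (h : ∀ j, X.col j = s j • Y.col j) : X = Y * Matrix.diagonal s := by
  ext i j
  rw [Matrix.mul_diagonal]
  simpa [mul_comm] using congrFun (h j) i

/-- A contraction that attains the nuclear norm of `A` is a polar factor of `A`. -/
lemma polar_of_reInner_eq_nuclearNorm {G A : Matrix a b ℂ} (hG : OpBound G 1)
    (h : reInner G A = nuclearNorm A) : Gᴴ * A = Aᴴ * G ∧ G * Gᴴ * A = A := by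
  obtain ⟨U, s, h1, h2, hs, hd, hn⟩ := exists_singular_basis A
  have hGle : ∀ j, euclNorm ((G * U).col j) ≤ 1 := by
    intro j
    have := hG (U.col j)
    rwa [euclNorm_col_of_isometry h1, mul_one] at this
  have hle : ∀ j ∈ Finset.univ, reDot ((G * U).col j) ((A * U).col j) ≤ s j := by
    intro j _
    refine (reDot_le _ _).trans ?_
    rw [euclNorm_col_of_gram hs hd]
    nlinarith [hs j, hGle j]
  -- Equality of the sums forces equality in every term. This is the equality case of
  -- Cauchy-Schwarz, and it determines `G` on the singular vectors with nonzero singular value.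
  rw [reInner_eq_sum_basis h2, hn, Finset.sum_eq_sum_iff_of_le hle] at h
  have hcol1 : ∀ j, (A * U).col j = (s j : ℂ) • (G * U).col j := by
    intro j
    have e := euclNorm_sub_sq ((A * U).col j) ((s j : ℂ) • (G * U).col j)
    rw [reDot_real_smul_right, reDot_comm, h j (Finset.mem_univ j), euclNorm_real_smul,
      euclNorm_col_of_gram hs hd, abs_of_nonneg (hs j)] at e
    have hz : euclNorm ((A * U).col j - (s j : ℂ) • (G * U).col j) ^ 2 ≤ 0 := by
      rw [e, mul_pow]
      have := mul_le_of_le_one_right (sq_nonneg (s j))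
        (pow_le_one₀ (n := 2) (euclNorm_nonneg _) (hGle j))
      nlinarith
    exact sub_eq_zero.mp (euclNorm_eq_zero.mp (pow_eq_zero_iff two_ne_zero |>.mp
      (le_antisymm hz (sq_nonneg _))))
  have hcol2 : ∀ j, (Gᴴ * A * U).col j = (s j : ℂ) • U.col j := by
    intro j
    have e := euclNorm_sub_sq (Gᴴ *ᵥ (A * U).col j) ((s j : ℂ) • U.col j)
    rw [reDot_real_smul_right, ← reDot_mulVec', reDot_comm ((A * U).col j),
      ← col_mul G, h j (Finset.mem_univ j), euclNorm_real_smul, euclNorm_col_of_isometry h1,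
      abs_of_nonneg (hs j)] at e
    have hb := hG.conjTranspose zero_le_one ((A * U).col j)
    rw [one_mul, euclNorm_col_of_gram hs hd] at hb
    have hz : euclNorm (Gᴴ *ᵥ (A * U).col j - (s j : ℂ) • U.col j) ^ 2 ≤ 0 := by
      rw [e]
      nlinarith [euclNorm_nonneg (Gᴴ *ᵥ (A * U).col j)]
    rw [Matrix.mul_assoc, col_mul]
    exact sub_eq_zero.mp (euclNorm_eq_zero.mp (pow_eq_zero_iff two_ne_zero |>.mp
      (le_antisymm hz (sq_nonneg _))))
  set S : Matrix b b ℂ := Matrix.diagonal (fun j => (s j : ℂ)) with hS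
  have hSH : Sᴴ = S := by
    rw [hS, Matrix.diagonal_conjTranspose]
    congr 1; ext j; simp
  have hA : A * U = G * U * S := eq_mul_diagonal_of_col hcol1
  have hGA : Gᴴ * A * U = U * S := eq_mul_diagonal_of_col hcol2
  have hGA' : Gᴴ * A = U * S * Uᴴ := by
    rw [← hGA, Matrix.mul_assoc _ U, h2, Matrix.mul_one]
  have hself : (Gᴴ * A)ᴴ = Gᴴ * A := by
    rw [hGA']
    simp only [Matrix.conjTranspose_mul, Matrix.conjTranspose_conjTranspose, hSH, Matrix.mul_assoc]
  refine ⟨?_, ?_⟩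
  · rw [← hself, Matrix.conjTranspose_mul, Matrix.conjTranspose_conjTranspose]
  · rw [Matrix.mul_assoc, hGA', ← Matrix.mul_assoc, ← Matrix.mul_assoc, ← hA, Matrix.mul_assoc, h2,
      Matrix.mul_one]

end Nuclear

/-! ### Supporting functionals and existence of minimisers -/

/-- At a minimiser of a nonnegative sublinear function over the translate of a subspace there is a
supporting functional that vanishes on the subspace. -/
lemma exists_supporting_functional {E : Type*} [AddCommGroup E] [Module ℝ E] (g : E → ℝ)
    (hsmul : ∀ c : ℝ, 0 < c → ∀ x, g (c • x) = c * g x) (hadd : ∀ x y, g (x + y) ≤ g x + g y)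
    (hnonneg : ∀ x, 0 ≤ g x) (S : Submodule ℝ E) (x : E) (hmin : ∀ v ∈ S, g x ≤ g (x + v)) :
    ∃ φ : E →ₗ[ℝ] ℝ, (∀ y, φ y ≤ g y) ∧ φ x = g x ∧ ∀ v ∈ S, φ v = 0 := by
  have g0 : g 0 = 0 := by
    have := hsmul 2 two_pos 0
    rw [smul_zero] at this
    linarith
  -- If `x ∈ S`, minimality against `-x` gives `g x = 0` and the zero functional serves. Otherwise
  -- the functional that is `0` on `S` and `g x` at `x` is well defined, and Hahn-Banach extends it.
  by_cases hx : x ∈ S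
  · have : g x = 0 := by
      have := hmin (-x) (S.neg_mem hx)
      rw [add_neg_cancel, g0] at this
      exact le_antisymm this (hnonneg x)
    exact ⟨0, by simpa using hnonneg, by simp [this], by simp⟩
  · let f : E →ₗ.[ℝ] ℝ := ⟨S, 0⟩
    have hxf : x ∉ f.domain := hx
    obtain ⟨φ, h1, h2⟩ := exists_extension_of_le_sublinear (f.supSpanSingleton x (g x) hxf) g hsmul
      hadd (by
        rintro ⟨y, hy⟩
        obtain ⟨v, hv, z, hz, rfl⟩ := Submodule.mem_sup.mp hy
        obtain ⟨c, rfl⟩ := Submodule.mem_span_singleton.mp hz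
        rw [LinearPMap.supSpanSingleton_apply_mk f x (g x) hxf v hv c]
        have hf : f ⟨v, hv⟩ = 0 := rfl
        simp only [hf, zero_add, RingHom.id_apply, smul_eq_mul]
        -- For `c ≤ 0` the nonnegativity of `g` suffices; for `c > 0` rescaling turns domination
        -- into minimality at `x`.
        rcases le_or_gt c 0 with hc | hc
        · exact (mul_nonpos_of_nonpos_of_nonneg hc (hnonneg x)).trans (hnonneg _)
        · have h := hmin (c⁻¹ • v) (S.smul_mem _ hv)
          have e : v + c • x = c • (x + c⁻¹ • v) := by
            rw [smul_add, smul_inv_smul₀ hc.ne', add_comm]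
          rw [e, hsmul c hc]
          exact mul_le_mul_of_nonneg_left h hc.le)
    refine ⟨φ, h2, ?_, fun v hv => ?_⟩
    · have := h1 ⟨x, Submodule.mem_sup_right (Submodule.mem_span_singleton_self x)⟩
      rw [LinearPMap.supSpanSingleton_apply_self] at this
      exact this
    · have := h1 ⟨v, Submodule.mem_sup_left hv⟩
      rw [LinearPMap.supSpanSingleton_apply_mk_of_mem f (g x) hxf hv] at this
      exact this

section Representation

variable {a b : Type*} [Fintype a] [Fintype b]

/-- The functional is only real linear, so each entry of `G` records two values: on the matrix unit
(real part) and on `Complex.I` times it (imaginary part). -/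
lemma exists_reInner_representation (φ : Matrix a b ℂ →ₗ[ℝ] ℝ) :
    ∃ G : Matrix a b ℂ, ∀ L, φ L = reInner G L := by
  classical
  refine ⟨Matrix.of fun i j =>
    ⟨φ (Matrix.single i j 1), φ (Matrix.single i j Complex.I)⟩, fun L => ?_⟩
  have hs : ∀ i j (z : ℂ), Matrix.single i j z =
      z.re • Matrix.single (m := a) (n := b) i j (1 : ℂ) + z.im • Matrix.single i j Complex.I := by
    intro i j z
    rw [Matrix.smul_single, Matrix.smul_single, ← Matrix.single_add]
    congr 1
    apply Complex.ext <;> simp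
  conv_lhs => rw [Matrix.matrix_eq_sum_single L]
  simp only [map_sum]
  rw [reInner_eq_reDot, reDot, dotProduct, Complex.re_sum, Fintype.sum_prod_type]
  refine Finset.sum_congr rfl fun i _ => Finset.sum_congr rfl fun j _ => ?_
  rw [hs, map_add, map_smul, map_smul]
  simp [mul_comm]

/-- A Lipschitz and coercive function on complex matrices has a minimiser. -/
lemma exists_minimizer (f : Matrix a b ℂ → ℝ) {K c d : ℝ} (hK : 0 ≤ K) (hc : 0 < c)
    (hlip : ∀ X Y, f X - f Y ≤ K * frobeniusNorm (X - Y))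
    (hcoer : ∀ X, c * frobeniusNorm X - d ≤ f X) : ∃ X, ∀ Y, f X ≤ f Y := by
  let e : EuclideanSpace ℂ (a × b) → Matrix a b ℂ := fun x => Matrix.of fun i j => x (i, j)
  have hnorm : ∀ x, frobeniusNorm (e x) = ‖x‖ := by
    intro x
    rw [frobeniusNorm_eq_euclNorm, euclNorm_eq_norm]
    rfl
  have hl : LipschitzWith K.toNNReal (f ∘ e) := by
    apply LipschitzWith.of_le_add_mul
    intro x y
    have := hlip (e x) (e y)
    have h2 : e x - e y = e (x - y) := rfl
    rw [h2, hnorm, ← dist_eq_norm] at this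
    rw [Real.coe_toNNReal K hK]
    simp only [Function.comp]
    linarith
  have ht : Filter.Tendsto (f ∘ e) (Filter.cocompact _) Filter.atTop := by
    have h1 : Filter.Tendsto (fun x : EuclideanSpace ℂ (a × b) => c * ‖x‖ - d)
        (Filter.cocompact _) Filter.atTop := by
      simp only [sub_eq_add_neg]
      exact Filter.tendsto_atTop_add_const_right _ _
        (tendsto_norm_cocompact_atTop.const_mul_atTop hc)
    refine Filter.tendsto_atTop_mono (fun x => ?_) h1
    have := hcoer (e x)
    rwa [hnorm] at this
  obtain ⟨x, hx⟩ := hl.continuous.exists_forall_le ht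
  exact ⟨e x, fun Y => hx (WithLp.toLp 2 fun q => Y q.1 q.2)⟩

end Representation

/-! ### The sum of column norms and its dual norm -/

section ColumnNorms

variable {a b : Type*} [Fintype a] [Fintype b]

lemma normOneTwo_nonneg (A : Matrix a b ℂ) : 0 ≤ normOneTwo A :=
  Finset.sum_nonneg fun _ _ => Real.sqrt_nonneg _

lemma normOneTwo_zero : normOneTwo (0 : Matrix a b ℂ) = 0 := by
  simp [normOneTwo, colNorm]

lemma normOneTwo_add_le (A B : Matrix a b ℂ) :
    normOneTwo (A + B) ≤ normOneTwo A + normOneTwo B := by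
  rw [normOneTwo, normOneTwo, normOneTwo, ← Finset.sum_add_distrib]
  exact Finset.sum_le_sum fun j _ => euclNorm_add_le (A.col j) (B.col j)

lemma normOneTwo_smul {r : ℝ} (hr : 0 ≤ r) (A : Matrix a b ℂ) :
    normOneTwo (r • A) = r * normOneTwo A := by
  rw [normOneTwo, normOneTwo, Finset.mul_sum]
  refine Finset.sum_congr rfl fun j _ => ?_
  have := euclNorm_real_smul r (A.col j)
  rwa [abs_of_nonneg hr] at this

lemma normOneTwo_le_frobeniusNorm (A : Matrix a b ℂ) :
    normOneTwo A ≤ Fintype.card b * frobeniusNorm A := by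
  calc normOneTwo A ≤ ∑ _j : b, frobeniusNorm A :=
        Finset.sum_le_sum fun j _ => euclNorm_col_le A j
    _ = _ := by simp

lemma reInner_le_normOneTwo {S : Matrix a b ℂ} {l : ℝ} (hS : ∀ j, euclNorm (S.col j) ≤ l)
    (A : Matrix a b ℂ) : reInner S A ≤ l * normOneTwo A := by
  rw [reInner_eq_sum, normOneTwo, Finset.mul_sum]
  exact Finset.sum_le_sum fun j _ => (reDot_le _ _).trans
    (mul_le_mul_of_nonneg_right (hS j) (euclNorm_nonneg _))

/-- Test against the matrix whose only nonzero column is the `j`-th column of `S`, in position `j`.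
-/
lemma euclNorm_col_le_of_reInner_le {S : Matrix a b ℂ} {l : ℝ} (hl : 0 ≤ l)
    (hS : ∀ A, reInner S A ≤ l * normOneTwo A) (j : b) : euclNorm (S.col j) ≤ l := by
  classical
  have h := hS (Matrix.vecMulVec (S.col j) (star (Pi.single j 1)))
  rw [reInner_vecMulVec, Matrix.mulVec_single_one, reDot_self] at h
  have hn : normOneTwo (Matrix.vecMulVec (S.col j) (star (Pi.single j (1 : ℂ)))) =
      euclNorm (S.col j) := by
    rw [normOneTwo, Finset.sum_eq_single j]
    · simp [colNorm, euclNorm, Matrix.vecMulVec_apply]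
    · intro i _ hij
      simp [colNorm, Matrix.vecMulVec_apply, hij]
    · simp
  rw [hn] at h
  exact euclNorm_le_of_sq_le hl h

end ColumnNorms

/-! ### The oracle problem and its dual variables -/

/-- Minimising `‖L‖_* + l ‖C‖_{1,2}` over all decompositions `L + C wᴴ = L₀ + C₀ wᴴ` that differ from
`(L₀, C₀)` by matrices with column space in the range of `U`: a minimiser exists, together with
dual variables certifying its optimality. -/
lemma exists_oracle_solution {t p r ι : Type*} [Fintype t] [Fintype p] [Fintype r] [Fintype ι]
    [DecidableEq p] [DecidableEq r] (L₀ : Matrix t p ℂ) (C₀ : Matrix t ι ℂ) (U : Matrix t r ℂ)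
    (hU : Uᴴ * U = 1) (w : Matrix p ι ℂ) {l : ℝ} (hl : 0 < l) :
    ∃ (B : Matrix r ι ℂ) (G : Matrix t p ℂ) (S : Matrix t ι ℂ), OpBound G 1 ∧
      (∀ j, euclNorm (S.col j) ≤ l) ∧ Uᴴ * G * w = Uᴴ * S ∧
      reInner G (L₀ - U * B * wᴴ) = nuclearNorm (L₀ - U * B * wᴴ) ∧
      reInner S (C₀ + U * B) = l * normOneTwo (C₀ + U * B) := by
  have hUb : OpBound U 1 := .of_isometry hU
  have hUle : ∀ X : Matrix r ι ℂ, frobeniusNorm (U * X) ≤ frobeniusNorm X := fun X => by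
    simpa using frobeniusNorm_mul_le_left zero_le_one hUb X
  have hUge : ∀ X : Matrix r ι ℂ, frobeniusNorm X ≤ frobeniusNorm (U * X) := fun X => by
    have := frobeniusNorm_mul_le_left zero_le_one (hUb.conjTranspose zero_le_one) (U * X)
    rwa [← Matrix.mul_assoc, hU, Matrix.one_mul, one_mul] at this
  -- Coercivity comes from the column-norm term alone: `U` preserves the Frobenius norm and `l > 0`.
  obtain ⟨B, hB⟩ := exists_minimizer
    (fun B : Matrix r ι ℂ => nuclearNorm (L₀ - U * B * wᴴ) + l * normOneTwo (C₀ + U * B))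
    (K := Real.sqrt (Fintype.card p) * frobeniusNorm w + l * Fintype.card ι) (c := l)
    (d := l * frobeniusNorm C₀)
    (by have := frobeniusNorm_nonneg w; positivity) hl
    (by
      intro X Y
      have h1 : nuclearNorm (L₀ - U * X * wᴴ) ≤ nuclearNorm (L₀ - U * Y * wᴴ) +
          Real.sqrt (Fintype.card p) * (frobeniusNorm w * frobeniusNorm (X - Y)) := by
        have e : L₀ - U * X * wᴴ = (L₀ - U * Y * wᴴ) + -(U * (X - Y) * wᴴ) := by
          rw [Matrix.mul_sub, Matrix.sub_mul]; abel
        rw [e]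
        refine (nuclearNorm_add_le _ _).trans (add_le_add le_rfl ?_)
        refine (nuclearNorm_le_frobeniusNorm _).trans
          (mul_le_mul_of_nonneg_left ?_ (Real.sqrt_nonneg _))
        rw [frobeniusNorm_neg]
        refine (frobeniusNorm_mul_le_right (frobeniusNorm_nonneg w)
          ((OpBound.frobenius w).conjTranspose (frobeniusNorm_nonneg w)) _).trans ?_
        exact mul_le_mul_of_nonneg_left (hUle _) (frobeniusNorm_nonneg w)
      have h2 : normOneTwo (C₀ + U * X) ≤ normOneTwo (C₀ + U * Y) +
          Fintype.card ι * frobeniusNorm (X - Y) := by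
        have e : C₀ + U * X = (C₀ + U * Y) + U * (X - Y) := by
          rw [Matrix.mul_sub]; abel
        rw [e]
        refine (normOneTwo_add_le _ _).trans (add_le_add le_rfl ?_)
        exact (normOneTwo_le_frobeniusNorm _).trans
          (mul_le_mul_of_nonneg_left (hUle _) (by positivity))
      have := mul_le_mul_of_nonneg_left h2 hl.le
      linarith)
    (by
      intro X
      have h1 := frobeniusNorm_sub_le (C₀ + U * X) C₀
      rw [add_sub_cancel_left] at h1
      have h2 := frobeniusNorm_le_normOneTwo (C₀ + U * X)
      have h3 := hUge X
      have h4 := nuclearNorm_nonneg (L₀ - U * X * wᴴ)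
      nlinarith)
  -- The range of `Φ` is the space of admissible directions. A supporting functional vanishing on it
  -- yields the stationarity relation `Uᴴ * G * w = Uᴴ * S`.
  let Φ : Matrix r ι ℂ →ₗ[ℝ] Matrix t p ℂ × Matrix t ι ℂ :=
    { toFun := fun Y => (-(U * Y * wᴴ), U * Y)
      map_add' := fun X Y => by
        ext <;> simp [Matrix.mul_add, Matrix.add_mul]; ring
      map_smul' := fun c X => by simp }
  obtain ⟨φ, hφ1, hφ2, hφ3⟩ := exists_supporting_functional
    (fun q : Matrix t p ℂ × Matrix t ι ℂ => nuclearNorm q.1 + l * normOneTwo q.2)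
    (fun c hc q => by
      simp only [Prod.smul_fst, Prod.smul_snd, nuclearNorm_smul hc.le, normOneTwo_smul hc.le]
      ring)
    (fun q q' => by
      have h1 := nuclearNorm_add_le q.1 q'.1
      have h2 := mul_le_mul_of_nonneg_left (normOneTwo_add_le q.2 q'.2) hl.le
      simp only [Prod.fst_add, Prod.snd_add]
      linarith)
    (fun q => add_nonneg (nuclearNorm_nonneg _) (mul_nonneg hl.le (normOneTwo_nonneg _)))
    (LinearMap.range Φ) (L₀ - U * B * wᴴ, C₀ + U * B) (by
      rintro _ ⟨Y, rfl⟩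
      have := hB (B + Y)
      have e1 : L₀ - U * B * wᴴ + -(U * Y * wᴴ) = L₀ - U * (B + Y) * wᴴ := by
        rw [Matrix.mul_add, Matrix.add_mul]; abel
      have e2 : C₀ + U * B + U * Y = C₀ + U * (B + Y) := by
        rw [Matrix.mul_add]; abel
      change _ ≤ nuclearNorm (L₀ - U * B * wᴴ + -(U * Y * wᴴ)) + l * normOneTwo (C₀ + U * B + U * Y)
      rw [e1, e2]
      exact this)
  obtain ⟨G, hG⟩ := exists_reInner_representation (φ ∘ₗ LinearMap.inl ℝ _ _)
  obtain ⟨S, hS⟩ := exists_reInner_representation (φ ∘ₗ LinearMap.inr ℝ _ _)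
  have hφ : ∀ L C, φ (L, C) = reInner G L + reInner S C := by
    intro L C
    rw [← hG, ← hS, LinearMap.comp_apply, LinearMap.comp_apply, ← map_add]
    simp
  have hGle : ∀ L, reInner G L ≤ nuclearNorm L := by
    intro L
    have := hφ1 (L, 0)
    rw [hφ, reInner_zero_right] at this
    simpa [normOneTwo_zero] using this
  have hSle : ∀ C, reInner S C ≤ l * normOneTwo C := by
    intro C
    have := hφ1 (0, C)
    rw [hφ, reInner_zero_right] at this
    simpa [nuclearNorm_zero] using this
  rw [hφ] at hφ2
  refine ⟨B, G, S, opBound_of_reInner_le_nuclearNorm hGle, euclNorm_col_le_of_reInner_le hl.le hSle,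
    ?_, ?_, ?_⟩
  · have h : ∀ Y, reInner (Uᴴ * S - Uᴴ * G * w) Y = 0 := by
      intro Y
      have := hφ3 _ (LinearMap.mem_range_self Φ Y)
      change φ (-(U * Y * wᴴ), U * Y) = 0 at this
      rw [hφ, reInner_neg_right] at this
      rw [reInner_sub_left, reInner_mul_left, Matrix.conjTranspose_conjTranspose,
        reInner_mul_right, reInner_mul_left, Matrix.conjTranspose_conjTranspose, ← Matrix.mul_assoc]
      linarith
    have := h (Uᴴ * S - Uᴴ * G * w)
    rw [reInner_self, pow_eq_zero_iff two_ne_zero, frobeniusNorm_eq_zero] at this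
    exact (sub_eq_zero.mp this).symm
  -- The two dual inequalities add up to an equality, so each of them is an equality.
  · have h1 := hGle (L₀ - U * B * wᴴ)
    have h2 := hSle (C₀ + U * B)
    simp only at hφ2
    linarith
  · have h1 := hGle (L₀ - U * B * wᴴ)
    have h2 := hSle (C₀ + U * B)
    simp only at hφ2
    linarith

/-! ### Construction of the dual certificate -/

section Certificate

variable {t p r ι : Type*} [Fintype t] [Fintype p] [Fintype r] [Fintype ι]

/-- If the range of `w` is almost orthogonal to the orthonormal columns of `V`, then `Vᴴ` has a
well-conditioned right inverse with values in the orthogonal complement of the range of `w`. -/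
lemma exists_lift_orthogonal [DecidableEq r] {V : Matrix p r ℂ} (hV : Vᴴ * V = 1)
    {w : Matrix p ι ℂ} (hw : ∀ z, w *ᵥ z = 0 → z = 0)
    (hVw : ∀ z, 36 * euclNorm (Vᴴ *ᵥ w *ᵥ z) ^ 2 ≤ euclNorm (w *ᵥ z) ^ 2) (d : r → ℂ) :
    ∃ Y, wᴴ *ᵥ Y = 0 ∧ Vᴴ *ᵥ Y = d ∧ 35 * euclNorm Y ^ 2 ≤ 36 * euclNorm d ^ 2 := by
  classical
  obtain ⟨J, -, hJ⟩ := exists_gram_inv hw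
  -- `A` is `V` projected onto the orthogonal complement of the range of `w`. The projection removes
  -- at most `1/36` of each squared norm, and `A (AᴴA)⁻¹ d` is the lift sought.
  set A : Matrix p r ℂ := V - w * (J * (wᴴ * V)) with hA
  have hwA : wᴴ * A = 0 := by
    rw [hA, Matrix.mul_sub, ← Matrix.mul_assoc wᴴ w, ← Matrix.mul_assoc, hJ, Matrix.one_mul,
      sub_self]
  have hlow : ∀ u, 35 * euclNorm u ^ 2 ≤ 36 * euclNorm (A *ᵥ u) ^ 2 := by
    intro u
    set z := (J * (wᴴ * V)) *ᵥ u with hz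
    have hVu : V *ᵥ u = A *ᵥ u + w *ᵥ z := by
      rw [hA, Matrix.sub_mulVec, hz, Matrix.mulVec_mulVec]; abel
    have h0 : reDot (A *ᵥ u) (w *ᵥ z) = 0 := by
      rw [reDot_mulVec', Matrix.mulVec_mulVec, hwA, Matrix.zero_mulVec, reDot_zero_left]
    have h1 := euclNorm_add_sq (A *ᵥ u) (w *ᵥ z)
    rw [← hVu, euclNorm_mulVec_of_isometry hV, h0] at h1
    have h2 : euclNorm (w *ᵥ z) ^ 2 = reDot (Vᴴ *ᵥ w *ᵥ z) u := by
      rw [← reDot_mulVec', hVu, reDot_add_right, reDot_comm, h0, reDot_self, zero_add]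
    have h3 := reDot_le (Vᴴ *ᵥ w *ᵥ z) u
    have h4 := hVw z
    nlinarith [sq_nonneg (36 * euclNorm (Vᴴ *ᵥ w *ᵥ z) - euclNorm u)]
  have hinj : ∀ u, A *ᵥ u = 0 → u = 0 := by
    intro u hu
    have := hlow u
    rw [hu, euclNorm_zero] at this
    have h0 : euclNorm u ^ 2 = 0 := by nlinarith [sq_nonneg (euclNorm u)]
    exact euclNorm_eq_zero.mp (pow_eq_zero_iff two_ne_zero |>.mp h0)
  obtain ⟨K, -, hK⟩ := exists_gram_inv hinj
  have hVA : Vᴴ * A = Aᴴ * A := by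
    have : Aᴴ * A = Vᴴ * A - (w * (J * (wᴴ * V)))ᴴ * A := by
      rw [← Matrix.sub_mul, ← Matrix.conjTranspose_sub]
    rw [this, Matrix.conjTranspose_mul, Matrix.mul_assoc, hwA, Matrix.mul_zero, sub_zero]
  have hd : (Aᴴ * A) *ᵥ K *ᵥ d = d := by rw [Matrix.mulVec_mulVec, hK, Matrix.one_mulVec]
  refine ⟨A *ᵥ K *ᵥ d, ?_, ?_, ?_⟩
  · rw [Matrix.mulVec_mulVec, hwA, Matrix.zero_mulVec]
  · rw [Matrix.mulVec_mulVec, hVA, hd]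
  · have h1 := euclNorm_mulVec_sq A (K *ᵥ d)
    rw [hd] at h1
    have h2 := reDot_le (K *ᵥ d) d
    have h3 := hlow (K *ᵥ d)
    set x := euclNorm (A *ᵥ K *ᵥ d)
    set u := euclNorm (K *ᵥ d)
    have hu : 0 ≤ u := euclNorm_nonneg _
    have hd0 := euclNorm_nonneg d
    have h4 : x ^ 2 ≤ u * euclNorm d := h1.trans_le h2
    nlinarith [sq_nonneg (35 * u - 36 * euclNorm d)]

/-- Let `A = diagonal s * Vᴴ - B * wᴴ` have the polar factor `E`. Then `E` is a coisometry, and its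
size on the complement of the range of `w` is controlled by that of `Vᴴ`. -/
lemma polar_factor_properties [DecidableEq r] {V : Matrix p r ℂ} (hV : Vᴴ * V = 1)
    {w : Matrix p ι ℂ} (hw : ∀ z, w *ᵥ z = 0 → z = 0)
    (hVw : ∀ z, 36 * euclNorm (Vᴴ *ᵥ w *ᵥ z) ^ 2 ≤ euclNorm (w *ᵥ z) ^ 2)
    {s : r → ℂ} (hs : ∀ i, s i ≠ 0) {A E : Matrix r p ℂ} {B : Matrix r ι ℂ}
    (hA : A = Matrix.diagonal s * Vᴴ - B * wᴴ) (hE : OpBound E 1)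
    (h1 : Eᴴ * A = Aᴴ * E) (h2 : E * Eᴴ * A = A) :
    E * Eᴴ = 1 ∧
      ∀ Y, wᴴ *ᵥ Y = 0 → 35 * euclNorm (E *ᵥ Y) ^ 2 ≤ 36 * euclNorm (Vᴴ *ᵥ Y) ^ 2 := by
  have hAY : ∀ Y, wᴴ *ᵥ Y = 0 → A *ᵥ Y = Matrix.diagonal s *ᵥ Vᴴ *ᵥ Y := by
    intro Y hY
    rw [hA, Matrix.sub_mulVec, ← Matrix.mulVec_mulVec, ← Matrix.mulVec_mulVec, hY,
      Matrix.mulVec_zero, sub_zero]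
  have hsurj : ∀ d, ∃ Y, A *ᵥ Y = d := by
    intro d
    obtain ⟨Y, hY1, hY2, -⟩ := exists_lift_orthogonal hV hw hVw (fun i => (s i)⁻¹ * d i)
    refine ⟨Y, ?_⟩
    rw [hAY Y hY1, hY2]
    ext i
    rw [Matrix.mulVec_diagonal, mul_inv_cancel_left₀ (hs i)]
  have hEE : E * Eᴴ = 1 := by
    -- Because `A` is onto, `E Eᴴ A = A` forces `E Eᴴ` to fix every vector.
    apply Matrix.ext_of_mulVec_single
    intro i
    obtain ⟨Y, hY⟩ := hsurj (Pi.single i 1)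
    rw [← hY, Matrix.mulVec_mulVec, h2, Matrix.one_mulVec]
  refine ⟨hEE, fun Y hY => ?_⟩
  -- Here `A = (E Aᴴ) E` with `E Aᴴ` injective, and on the complement of the range of `w` the value
  -- of `A` depends on `Vᴴ Y` only. So `Y` may be replaced by the short lift `Y'` without changing
  -- `E Y`.
  obtain ⟨Y', hY1, hY2, hY3⟩ := exists_lift_orthogonal hV hw hVw (Vᴴ *ᵥ Y)
  have hAE : (E * Aᴴ) * E = A := by rw [Matrix.mul_assoc, ← h1, ← Matrix.mul_assoc, h2]
  have hherm : (E * Aᴴ)ᴴ = E * Aᴴ := by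
    have h : A * Eᴴ = E * Aᴴ := by
      calc A * Eᴴ = ((E * Aᴴ) * E) * Eᴴ := by rw [hAE]
        _ = (E * Aᴴ) * (E * Eᴴ) := Matrix.mul_assoc _ _ _
        _ = E * Aᴴ := by rw [hEE, Matrix.mul_one]
    rw [Matrix.conjTranspose_mul, Matrix.conjTranspose_conjTranspose, h]
  have hK : ∀ x, (E * Aᴴ) *ᵥ x = 0 → x = 0 := by
    intro x hx
    obtain ⟨y, hy⟩ := hsurj x
    have hy' : (E * Aᴴ) *ᵥ E *ᵥ y = x := by rw [Matrix.mulVec_mulVec, hAE, hy]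
    have h0 : reDot x ((E * Aᴴ) *ᵥ E *ᵥ y) = 0 := by
      rw [reDot_mulVec', hherm, hx, reDot_zero_left]
    rw [hy', reDot_self] at h0
    exact euclNorm_eq_zero.mp (pow_eq_zero_iff two_ne_zero |>.mp h0)
  have hEY : E *ᵥ Y = E *ᵥ Y' := by
    rw [← sub_eq_zero]
    apply hK
    rw [Matrix.mulVec_sub, Matrix.mulVec_mulVec, Matrix.mulVec_mulVec, hAE, hAY Y hY, hAY Y' hY1,
      hY2, sub_self]
  have h3 := hE Y'
  rw [one_mul] at h3
  rw [hEY]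
  have := pow_le_pow_left₀ (euclNorm_nonneg _) h3 2
  linarith

/-- The part of the dual certificate that is orthogonal to the tangent space. -/
lemma exists_certificate [DecidableEq r] {U : Matrix t r ℂ} (hU : Uᴴ * U = 1) {E : Matrix r p ℂ}
    (hE : E * Eᴴ = 1) {w : Matrix p ι ℂ} (hw : ∀ z, w *ᵥ z = 0 → z = 0) {S : Matrix t ι ℂ}
    (hES : E * w = Uᴴ * S) (hS : ∀ z, 4 * euclNorm (S *ᵥ z) ^ 2 ≤ euclNorm (w *ᵥ z) ^ 2) :
    ∃ Q : Matrix t p ℂ, Uᴴ * Q = 0 ∧ Q * Eᴴ = 0 ∧ Q * w = S - U * (Uᴴ * S) ∧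
      OpBound Q (1 / 2) ∧
      ∀ Y, wᴴ *ᵥ Y = 0 → 12 * euclNorm (Q *ᵥ Y) ^ 2 ≤ euclNorm (E *ᵥ Y) ^ 2 := by
  classical
  set A : Matrix p ι ℂ := w - Eᴴ * (E * w) with hA
  set T : Matrix t ι ℂ := S - U * (Uᴴ * S) with hT
  have hEA : E * A = 0 := by
    rw [hA, Matrix.mul_sub, ← Matrix.mul_assoc E Eᴴ, hE, Matrix.one_mul, sub_self]
  have hUT : Uᴴ * T = 0 := by
    rw [hT, Matrix.mul_sub, ← Matrix.mul_assoc Uᴴ U, hU, Matrix.one_mul, sub_self]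
  have hAz : ∀ z, euclNorm (w *ᵥ z) ^ 2 =
      euclNorm (A *ᵥ z) ^ 2 + euclNorm (Uᴴ *ᵥ S *ᵥ z) ^ 2 := by
    intro z
    have e : w *ᵥ z = A *ᵥ z + Eᴴ *ᵥ (Uᴴ * S) *ᵥ z := by
      rw [hA, Matrix.sub_mulVec, hES, Matrix.mulVec_mulVec]; abel
    have h0 : reDot (A *ᵥ z) (Eᴴ *ᵥ (Uᴴ * S) *ᵥ z) = 0 := by
      rw [← reDot_mulVec, Matrix.mulVec_mulVec, hEA, Matrix.zero_mulVec, reDot_zero_left]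
    rw [e, euclNorm_add_sq, h0,
      euclNorm_mulVec_of_isometry (A := Eᴴ) (by rwa [Matrix.conjTranspose_conjTranspose]),
      ← Matrix.mulVec_mulVec]
    ring
  have hTz : ∀ z, euclNorm (S *ᵥ z) ^ 2 =
      euclNorm (T *ᵥ z) ^ 2 + euclNorm (Uᴴ *ᵥ S *ᵥ z) ^ 2 := by
    intro z
    have e : S *ᵥ z = T *ᵥ z + U *ᵥ (Uᴴ * S) *ᵥ z := by
      rw [hT, Matrix.sub_mulVec, Matrix.mulVec_mulVec]; abel
    have h0 : reDot (T *ᵥ z) (U *ᵥ (Uᴴ * S) *ᵥ z) = 0 := by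
      rw [reDot_mulVec', Matrix.mulVec_mulVec, hUT, Matrix.zero_mulVec, reDot_zero_left]
    conv_lhs => rw [e, euclNorm_add_sq, h0, euclNorm_mulVec_of_isometry hU, ← Matrix.mulVec_mulVec]
    ring
  have hinj : ∀ z, A *ᵥ z = 0 → z = 0 := by
    intro z hz
    have h1 := hAz z
    have h2 := hTz z
    have h3 := hS z
    rw [hz, euclNorm_zero] at h1
    have h0 : euclNorm (w *ᵥ z) ^ 2 = 0 := by
      nlinarith [sq_nonneg (euclNorm (w *ᵥ z)), sq_nonneg (euclNorm (T *ᵥ z))]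
    exact hw z (euclNorm_eq_zero.mp (pow_eq_zero_iff two_ne_zero |>.mp h0))
  obtain ⟨J, hJ1, hJ2⟩ := exists_gram_inv hinj
  have hAA : Aᴴ * A = Aᴴ * w := by
    conv_lhs => rw [hA, Matrix.mul_sub, ← hA]
    have : Aᴴ * Eᴴ = 0 := by rw [← Matrix.conjTranspose_mul, hEA, Matrix.conjTranspose_zero]
    rw [← Matrix.mul_assoc Aᴴ Eᴴ, this, Matrix.zero_mul, sub_zero]
  have hproj : ∀ x, euclNorm (A *ᵥ (J * Aᴴ) *ᵥ x) ^ 2 = reDot (A *ᵥ (J * Aᴴ) *ᵥ x) x := by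
    intro x
    rw [euclNorm_mulVec_sq, Matrix.mulVec_mulVec, ← Matrix.mul_assoc, hJ2, Matrix.one_mul,
      ← reDot_mulVec]
  -- Since `E w = Uᴴ S`, the same term splits off from `w z` (leaving `A z`) and from `S z` (leaving
  -- `T z`). Hence `4‖Sz‖² ≤ ‖wz‖²` passes to `4‖Tz‖² ≤ ‖Az‖²`, even with `3‖UᴴSz‖²` to spare.
  have hQle : ∀ x, 4 * euclNorm ((T * (J * Aᴴ)) *ᵥ x) ^ 2 ≤
      euclNorm (A *ᵥ (J * Aᴴ) *ᵥ x) ^ 2 := by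
    intro x
    rw [← Matrix.mulVec_mulVec]
    have h1 := hAz ((J * Aᴴ) *ᵥ x)
    have h2 := hTz ((J * Aᴴ) *ᵥ x)
    have h3 := hS ((J * Aᴴ) *ᵥ x)
    nlinarith [sq_nonneg (euclNorm (Uᴴ *ᵥ S *ᵥ (J * Aᴴ) *ᵥ x))]
  refine ⟨T * (J * Aᴴ), ?_, ?_, ?_, ?_, ?_⟩
  · rw [← Matrix.mul_assoc, hUT, Matrix.zero_mul]
  · have : Aᴴ * Eᴴ = 0 := by rw [← Matrix.conjTranspose_mul, hEA, Matrix.conjTranspose_zero]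
    rw [Matrix.mul_assoc, Matrix.mul_assoc, this, Matrix.mul_zero, Matrix.mul_zero]
  · rw [Matrix.mul_assoc, Matrix.mul_assoc, ← hAA, hJ1, Matrix.mul_one]
  · intro x
    have h1 := hQle x
    have h2 : euclNorm (A *ᵥ (J * Aᴴ) *ᵥ x) ≤ euclNorm x :=
      euclNorm_le_of_sq_le (euclNorm_nonneg x) (by
        rw [hproj, mul_comm]; exact reDot_le _ _)
    refine abs_le_of_sq_le_sq' ?_ (by have := euclNorm_nonneg x; positivity) |>.2
    nlinarith [euclNorm_nonneg (A *ᵥ (J * Aᴴ) *ᵥ x)]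
  · intro Y hY
    have h1 := hQle Y
    have h0 := hproj Y
    obtain ⟨z, hz⟩ : ∃ z, z = (J * Aᴴ) *ᵥ Y := ⟨_, rfl⟩
    rw [← hz] at h0 h1
    have h2 := hAz z
    have h3 := hTz z
    have h4 := hS z
    have h5 : euclNorm (A *ᵥ z) ^ 2 ≤ euclNorm (Uᴴ *ᵥ S *ᵥ z) * euclNorm (E *ᵥ Y) := by
      have e : reDot (A *ᵥ z) Y = reDot (Uᴴ *ᵥ S *ᵥ z) (-(E *ᵥ Y)) := by
        rw [reDot_neg_right, hA, Matrix.sub_mulVec, reDot_sub_left, reDot_mulVec w, hY,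
          reDot_zero_right, hES, ← Matrix.mulVec_mulVec, reDot_mulVec Eᴴ,
          Matrix.conjTranspose_conjTranspose, ← Matrix.mulVec_mulVec, zero_sub]
      rw [h0, e, ← euclNorm_neg (E *ᵥ Y)]
      exact reDot_le _ _
    generalize euclNorm (Uᴴ *ᵥ S *ᵥ z) = α at *
    generalize euclNorm (A *ᵥ z) = β at *
    -- The spare term of the splitting is used here. With `β² ≤ α ‖EY‖` it gives `α ≤ ‖EY‖ / 3` and
    -- `β² ≤ ‖EY‖² / 3`, whence the constant `12 = 4 · 3`.
    have h6 : 3 * α ^ 2 ≤ β ^ 2 := by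
      nlinarith [sq_nonneg (euclNorm (T *ᵥ z))]
    nlinarith [sq_nonneg (3 * α - euclNorm (E *ᵥ Y))]

end Certificate

/-! ### Error bounds from the certificate -/

section Recovery

variable {t p r ι κ : Type*} [Fintype t] [Fintype p] [Fintype r] [Fintype ι] [Fintype κ]

omit [Fintype κ] in
lemma reInner_mul_left' (A : Matrix t p ℂ) (U : Matrix t r ℂ) (B : Matrix r p ℂ) :
    reInner A (U * B) = reInner (Uᴴ * A) B := by
  rw [reInner_mul_left, Matrix.conjTranspose_conjTranspose]

lemma reInner_mul_right' (A : Matrix t p ℂ) (B : Matrix t r ℂ) (C : Matrix r p ℂ) :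
    reInner A (B * C) = reInner (A * Cᴴ) B := by
  rw [reInner_mul_right, Matrix.conjTranspose_conjTranspose]

lemma frobeniusNorm_smul {c : ℝ} (hc : 0 ≤ c) (A : Matrix t p ℂ) :
    frobeniusNorm (c • A) = c * frobeniusNorm A := by
  have := euclNorm_real_smul c (fun q : t × p => A q.1 q.2)
  rw [abs_of_nonneg hc, ← frobeniusNorm_eq_euclNorm] at this
  rw [← this, frobeniusNorm_eq_euclNorm]
  rfl

/-- `1 - P Pᴴ` is an orthogonal projection, so its squared Frobenius norm is its trace. -/
lemma frobeniusNorm_one_sub_sq {m r : Type*} [Fintype m] [Fintype r] [DecidableEq m]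
    [DecidableEq r] {P : Matrix m r ℂ} (hP : Pᴴ * P = 1) :
    frobeniusNorm (1 - P * Pᴴ) ^ 2 = Fintype.card m - Fintype.card r := by
  have e : (1 - P * Pᴴ)ᴴ * (1 - P * Pᴴ) = 1 - P * Pᴴ := by
    have h1 : P * Pᴴ * (P * Pᴴ) = P * Pᴴ := by
      rw [Matrix.mul_assoc, ← Matrix.mul_assoc Pᴴ, hP, Matrix.one_mul]
    rw [Matrix.conjTranspose_sub, Matrix.conjTranspose_mul, Matrix.conjTranspose_conjTranspose,
      Matrix.conjTranspose_one, Matrix.sub_mul, Matrix.mul_sub, Matrix.mul_sub, h1]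
    simp
  rw [← reInner_self, reInner, e, Matrix.trace_sub, Matrix.trace_mul_comm, hP]
  simp

lemma frobeniusNorm_sub_proj_sq {m r k : Type*} [Fintype m] [Fintype r] [Fintype k]
    [DecidableEq r] {P : Matrix m r ℂ} (hP : Pᴴ * P = 1) (A : Matrix m k ℂ) :
    frobeniusNorm (A - P * (Pᴴ * A)) ^ 2 + frobeniusNorm (Pᴴ * A) ^ 2 = frobeniusNorm A ^ 2 := by
  have e : A = (A - P * (Pᴴ * A)) + P * (Pᴴ * A) := by abel
  have h0 : reInner (A - P * (Pᴴ * A)) (P * (Pᴴ * A)) = 0 := by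
    rw [reInner_mul_left', Matrix.mul_sub, ← Matrix.mul_assoc Pᴴ P, hP, Matrix.one_mul, sub_self,
      reInner_zero_left]
  have h1 : reInner (P * (Pᴴ * A)) (P * (Pᴴ * A)) = frobeniusNorm (Pᴴ * A) ^ 2 := by
    rw [reInner_mul_left, ← Matrix.mul_assoc Pᴴ P, hP, Matrix.one_mul, reInner_self]
  conv_rhs => rw [e, ← reInner_self, reInner_add_left, reInner_add_right, reInner_add_right,
    reInner_comm (P * (Pᴴ * A)) (A - _), h0, h1, reInner_self]
  ring

/-- The dual certificate is small on the columns outside the support. -/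
lemma euclNorm_certificate_le [DecidableEq r] {U : Matrix t r ℂ} (hU : Uᴴ * U = 1)
    {V : Matrix p r ℂ} {E : Matrix r p ℂ} {w : Matrix p ι ℂ} {S : Matrix t ι ℂ} {Q : Matrix t p ℂ}
    (hES : E * w = Uᴴ * S) (hQw : Q * w = S - U * (Uᴴ * S))
    (hEY : ∀ Y, wᴴ *ᵥ Y = 0 → 35 * euclNorm (E *ᵥ Y) ^ 2 ≤ 36 * euclNorm (Vᴴ *ᵥ Y) ^ 2)
    (hQY : ∀ Y, wᴴ *ᵥ Y = 0 → 12 * euclNorm (Q *ᵥ Y) ^ 2 ≤ euclNorm (E *ᵥ Y) ^ 2)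
    {σ l m ε μ : ℝ} (hσ : 0 < σ) (hl : 0 < l) (hm : 0 ≤ m) (hε : 0 ≤ ε) (hμ : 0 ≤ μ)
    (hw : ∀ z, euclNorm z ^ 2 ≤ σ * euclNorm (w *ᵥ z) ^ 2)
    (hS : OpBound S (l * m)) (hVw : OpBound (Vᴴ * w) (ε * m))
    {v : p → ℂ} (hwv : euclNorm (wᴴ *ᵥ v) ≤ m * μ) (hVv : euclNorm (Vᴴ *ᵥ v) ≤ ε)
    (hsmall : ε + l * (m ^ 2 * σ * μ) ≤ l / 3) :
    euclNorm ((U * E + Q) *ᵥ v) ≤ l / 2 := by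
  classical
  have hinj : ∀ z, w *ᵥ z = 0 → z = 0 := by
    intro z hz
    have := hw z
    rw [hz, euclNorm_zero] at this
    have h0 : euclNorm z ^ 2 = 0 := by nlinarith [sq_nonneg (euclNorm z)]
    exact euclNorm_eq_zero.mp (pow_eq_zero_iff two_ne_zero |>.mp h0)
  obtain ⟨J, -, hJ⟩ := exists_gram_inv hinj
  obtain ⟨g, hg⟩ : ∃ g, g = J *ᵥ wᴴ *ᵥ v := ⟨_, rfl⟩
  have hGg : (wᴴ * w) *ᵥ g = wᴴ *ᵥ v := by rw [hg, Matrix.mulVec_mulVec, hJ, Matrix.one_mulVec]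
  obtain ⟨Y, hY⟩ : ∃ Y, Y = v - w *ᵥ g := ⟨_, rfl⟩
  have hwY : wᴴ *ᵥ Y = 0 := by
    rw [hY, Matrix.mulVec_sub, Matrix.mulVec_mulVec, hGg, sub_self]
  have hgle : euclNorm g ≤ σ * (m * μ) := by
    apply euclNorm_le_of_sq_le (by positivity)
    refine (hw g).trans ?_
    rw [euclNorm_mulVec_sq, hGg, mul_assoc]
    refine mul_le_mul_of_nonneg_left ((reDot_le _ _).trans ?_) hσ.le
    rw [mul_comm]
    exact mul_le_mul_of_nonneg_right hwv (euclNorm_nonneg g)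
  -- Here `w g` is the projection of `v` onto the range of `w`. On that range the certificate equals
  -- `S`; on the remainder `Y` the estimates through `Vᴴ` apply.
  have hdec : (U * E + Q) *ᵥ v = S *ᵥ g + (U *ᵥ E *ᵥ Y + Q *ᵥ Y) := by
    have e1 : (U * E + Q) * w = S := by
      rw [Matrix.add_mul, Matrix.mul_assoc, hES, hQw]; abel
    have e2 : v = w *ᵥ g + Y := by rw [hY]; abel
    conv_lhs => rw [e2]
    rw [Matrix.mulVec_add, Matrix.mulVec_mulVec, e1, Matrix.add_mulVec, ← Matrix.mulVec_mulVec]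
  set x := m ^ 2 * σ * μ with hx
  have hx0 : 0 ≤ x := by positivity
  have hSg : euclNorm (S *ᵥ g) ≤ l * x := by
    refine (hS g).trans ((mul_le_mul_of_nonneg_left hgle (by positivity)).trans_eq ?_)
    rw [hx]; ring
  have hd : euclNorm (Vᴴ *ᵥ Y) ≤ ε * (1 + x) := by
    rw [hY, Matrix.mulVec_sub, Matrix.mulVec_mulVec]
    refine (euclNorm_sub_le _ _).trans ?_
    have h1 := (hVw g).trans (mul_le_mul_of_nonneg_left hgle (by positivity))
    have h2 : ε * m * (σ * (m * μ)) = ε * x := by rw [hx]; ring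
    linarith
  -- The rationals `203/200` and `3/10` exceed `√(36/35)` and `1/√12`, and `203/200 · 13/10 ≤ 4/3`.
  have he : euclNorm (E *ᵥ Y) ≤ 203 / 200 * (ε * (1 + x)) := by
    refine abs_le_of_sq_le_sq' ?_ (by positivity) |>.2
    have := pow_le_pow_left₀ (euclNorm_nonneg _) hd 2
    nlinarith [hEY Y hwY]
  have hq : euclNorm (Q *ᵥ Y) ≤ 3 / 10 * euclNorm (E *ᵥ Y) := by
    refine abs_le_of_sq_le_sq' ?_ (by have := euclNorm_nonneg (E *ᵥ Y); positivity) |>.2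
    nlinarith [hQY Y hwY, sq_nonneg (euclNorm (E *ᵥ Y))]
  have h1 := euclNorm_add_le (S *ᵥ g) (U *ᵥ E *ᵥ Y + Q *ᵥ Y)
  have h2 := euclNorm_add_le (U *ᵥ E *ᵥ Y) (Q *ᵥ Y)
  rw [euclNorm_mulVec_of_isometry hU] at h2
  rw [hdec]
  have h3 : euclNorm (S *ᵥ g + (U *ᵥ E *ᵥ Y + Q *ᵥ Y)) ≤ l * x + 4 / 3 * (ε * (1 + x)) := by
    have : 0 ≤ ε * (1 + x) := by positivity
    linarith
  have h4 : ε * (1 + x) ≤ (l / 3 - l * x) * (1 + x) :=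
    mul_le_mul_of_nonneg_right (by linarith) (by positivity)
  -- The bound is `l (4/9 + x/9 - 4x²/3)`, largest at `x = 1/24` and there still below `l/2`.
  nlinarith [mul_nonneg hl.le (sq_nonneg (x - 1 / 24))]

/-- Optimality of `(L, C₁, C₂)` against `(L₀, C₀, 0)` bounds the part of the error that is
orthogonal to the tangent space. -/
lemma error_le_of_certificate [DecidableEq p] [DecidableEq r] {U : Matrix t r ℂ}
    (hU : Uᴴ * U = 1) {E : Matrix r p ℂ} (hE : E * Eᴴ = 1) {w : Matrix p ι ℂ} {w' : Matrix p κ ℂ}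
    {S : Matrix t ι ℂ} {Q : Matrix t p ℂ} (hES : E * w = Uᴴ * S) (hUQ : Uᴴ * Q = 0)
    (hQE : Q * Eᴴ = 0) (hQw : Q * w = S - U * (Uᴴ * S)) (hQ : OpBound Q (1 / 2)) {l : ℝ}
    (hS : ∀ j, euclNorm (S.col j) ≤ l) (hw' : ∀ j, euclNorm ((U * E + Q) *ᵥ w'.col j) ≤ l / 2)
    {L L₀ : Matrix t p ℂ} {C₁ C₀ : Matrix t ι ℂ} {C₂ : Matrix t κ ℂ}
    (hL₀ : U * (Uᴴ * L₀) = L₀) (hnuc : reInner (U * E) L₀ = nuclearNorm L₀)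
    (hC₀ : reInner S C₀ = l * normOneTwo C₀)
    (hopt : nuclearNorm L + l * (normOneTwo C₁ + normOneTwo C₂) ≤
      nuclearNorm L₀ + l * normOneTwo C₀)
    {X D : Matrix t p ℂ} (hX : X = (L - L₀) - U * (Uᴴ * (L - L₀))) (hD : D = X - X * Eᴴ * E) :
    frobeniusNorm D + l * normOneTwo C₂ ≤ 2 * (frobeniusNorm (U * E + Q) *
      frobeniusNorm (L - L₀ + (C₁ - C₀) * wᴴ + C₂ * w'ᴴ)) := by
  have hUX : Uᴴ * X = 0 := by
    rw [hX, Matrix.mul_sub, ← Matrix.mul_assoc, hU, Matrix.one_mul, sub_self]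
  have hUD : Uᴴ * D = 0 := by
    rw [hD, Matrix.mul_sub, Matrix.mul_assoc X, ← Matrix.mul_assoc Uᴴ X, hUX, Matrix.zero_mul,
      sub_self]
  have hDE : D * Eᴴ = 0 := by
    rw [hD, Matrix.sub_mul, Matrix.mul_assoc _ E, hE, Matrix.mul_one, sub_self]
  set δ := frobeniusNorm D with hδ
  have hδ0 : 0 ≤ δ := frobeniusNorm_nonneg D
  have hDL : reInner D (L - L₀) = δ ^ 2 := by
    have e1 : L - L₀ = X + U * (Uᴴ * (L - L₀)) := by rw [hX]; abel
    have e2 : X = D + X * Eᴴ * E := by rw [hD]; abel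
    rw [e1, reInner_add_right, reInner_mul_left', hUD, reInner_zero_left, add_zero, e2,
      reInner_add_right, reInner_mul_right', hDE, reInner_zero_left, add_zero, reInner_self]
  -- The slack of `Q` is spent on a multiple of `D` of norm `1/2`, which gains `δ/2` in the pairing.
  -- For `δ = 0` the division convention gives `Y = 0`.
  obtain ⟨Y, hY⟩ : ∃ Y, Y = (1 / (2 * δ)) • D := ⟨_, rfl⟩
  have hYb : OpBound Y (1 / 2) := by
    intro x
    refine (OpBound.frobenius Y x).trans (mul_le_mul_of_nonneg_right ?_ (euclNorm_nonneg x))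
    rw [hY, frobeniusNorm_smul (by positivity), ← hδ]
    rcases hδ0.eq_or_lt with h | h
    · rw [← h]; norm_num
    · apply le_of_eq; field_simp
  have hYL : reInner Y (L - L₀) = δ / 2 := by
    rw [hY, reInner_smul_left, hDL]
    rcases hδ0.eq_or_lt with h | h
    · rw [← h]; norm_num
    · field_simp
  have hUF : Uᴴ * (Q + Y) = 0 := by
    rw [Matrix.mul_add, hUQ, hY, Matrix.mul_smul, hUD, smul_zero, add_zero]
  have hFE : (Q + Y) * Eᴴ = 0 := by
    rw [Matrix.add_mul, hQE, hY, Matrix.smul_mul, hDE, smul_zero, add_zero]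
  have hF : OpBound (U * E + (Q + Y)) 1 := by
    intro x
    rw [one_mul]
    refine abs_le_of_sq_le_sq' ?_ (euclNorm_nonneg x) |>.2
    have e0 : reDot (U *ᵥ E *ᵥ x) ((Q + Y) *ᵥ x) = 0 := by
      rw [reDot_mulVec, Matrix.mulVec_mulVec, hUF, Matrix.zero_mulVec, reDot_zero_right]
    -- `Q + Y` sees only the part of `x` orthogonal to the range of `Eᴴ`, and its range is
    -- orthogonal to that of `U`. By Pythagoras the sum with `U E` remains a contraction.
    have e1 : (Q + Y) *ᵥ x = (Q + Y) *ᵥ (x - Eᴴ *ᵥ E *ᵥ x) := by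
      rw [Matrix.mulVec_sub, Matrix.mulVec_mulVec _ _ Eᴴ, hFE, Matrix.zero_mulVec, sub_zero]
    have h1 := (hQ.add hYb) (x - Eᴴ *ᵥ E *ᵥ x)
    rw [← e1] at h1
    rw [add_halves, one_mul] at h1
    have h2 := pow_le_pow_left₀ (euclNorm_nonneg _) h1 2
    rw [euclNorm_sub_sq, reDot_comm, reDot_mulVec Eᴴ,
      Matrix.conjTranspose_conjTranspose, reDot_self,
      euclNorm_mulVec_of_isometry (A := Eᴴ) (by rwa [Matrix.conjTranspose_conjTranspose])] at h2
    rw [Matrix.add_mulVec, ← Matrix.mulVec_mulVec, euclNorm_add_sq, e0,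
      euclNorm_mulVec_of_isometry hU]
    linarith
  have h1 := reInner_le_nuclearNorm hF L
  have e1 : reInner (U * E + (Q + Y)) L = nuclearNorm L₀ + reInner (U * E + Q) (L - L₀) + δ / 2 := by
    have : L = L₀ + (L - L₀) := by abel
    have h0 : reInner (Q + Y) L₀ = 0 := by
      rw [← hL₀, reInner_mul_left', hUF, reInner_zero_left]
    conv_lhs => rw [this, reInner_add_right, reInner_add_left, hnuc, h0, ← add_assoc,
      reInner_add_left, hYL]
    ring
  have h2 := reInner_le_normOneTwo hS C₁
  have h3 : reInner ((U * E + Q) * w') C₂ ≤ l / 2 * normOneTwo C₂ :=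
    reInner_le_normOneTwo (S := (U * E + Q) * w') hw' C₂
  have hQS : (U * E + Q) * w = S := by
    rw [Matrix.add_mul, Matrix.mul_assoc, hES, hQw]; abel
  have e2 : reInner (U * E + Q) (L - L₀ + (C₁ - C₀) * wᴴ + C₂ * w'ᴴ) =
      reInner (U * E + Q) (L - L₀) + (reInner S C₁ - reInner S C₀) +
        reInner ((U * E + Q) * w') C₂ := by
    rw [← reInner_sub_right S, reInner_add_right, reInner_add_right, reInner_mul_right',
      reInner_mul_right', Matrix.conjTranspose_conjTranspose, Matrix.conjTranspose_conjTranspose,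
      hQS]
  have h4 := reInner_le (U * E + Q) (-(L - L₀ + (C₁ - C₀) * wᴴ + C₂ * w'ᴴ))
  rw [reInner_neg_right, frobeniusNorm_neg, e2] at h4
  linarith

omit [Fintype κ] [Fintype ι] in
/-- The Frobenius norm of a matrix of spectral norm at most `1 / 2` that is supported on the
orthogonal complements of two `r`-dimensional spaces, plus a partial isometry of rank `r`. -/
lemma frobeniusNorm_certificate_sq_le [DecidableEq r] {U : Matrix t r ℂ}
    (hU : Uᴴ * U = 1) {E : Matrix r p ℂ} (hE : E * Eᴴ = 1) {Q : Matrix t p ℂ} (hUQ : Uᴴ * Q = 0)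
    (hQE : Q * Eᴴ = 0) (hQ : OpBound Q (1 / 2)) :
    4 * frobeniusNorm (U * E + Q) ^ 2 ≤
      ((min (Fintype.card t) (Fintype.card p) : ℕ) : ℝ) + 3 * Fintype.card r := by
  classical
  have h0 : frobeniusNorm (U * E + Q) ^ 2 = Fintype.card r + frobeniusNorm Q ^ 2 := by
    have e1 : reInner (U * E) (U * E) = Fintype.card r := by
      rw [reInner_mul_left, ← Matrix.mul_assoc, hU, Matrix.one_mul, reInner, Matrix.trace_mul_comm,
        hE]
      simp
    have e2 : reInner (U * E) Q = 0 := by rw [reInner_mul_left, hUQ, reInner_zero_right]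
    rw [← reInner_self, reInner_add_left, reInner_add_right, reInner_add_right, e1,
      reInner_comm Q, e2, reInner_self]
    ring
  have h1 : 4 * frobeniusNorm Q ^ 2 ≤ Fintype.card p - Fintype.card r := by
    have e : Q = Q * (1 - Eᴴ * Eᴴᴴ) := by
      rw [Matrix.mul_sub, ← Matrix.mul_assoc, hQE, Matrix.zero_mul, Matrix.mul_one, sub_zero]
    have h := frobeniusNorm_mul_le_left (by norm_num) hQ (1 - Eᴴ * Eᴴᴴ)
    rw [← e] at h
    have h2 := pow_le_pow_left₀ (frobeniusNorm_nonneg _) h 2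
    rw [mul_pow, frobeniusNorm_one_sub_sq (P := Eᴴ) (by rwa [Matrix.conjTranspose_conjTranspose])] at h2
    linarith
  have h2 : 4 * frobeniusNorm Q ^ 2 ≤ Fintype.card t - Fintype.card r := by
    have e : Q = (1 - U * Uᴴ) * Q := by
      rw [Matrix.sub_mul, Matrix.mul_assoc, hUQ, Matrix.mul_zero, Matrix.one_mul, sub_zero]
    have h := frobeniusNorm_mul_le_right (by norm_num) hQ (1 - U * Uᴴ)
    rw [← e] at h
    have h2 := pow_le_pow_left₀ (frobeniusNorm_nonneg _) h 2
    rw [mul_pow, frobeniusNorm_one_sub_sq hU] at h2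
    linarith
  rw [h0, Nat.cast_min]
  rcases le_total (Fintype.card t : ℝ) (Fintype.card p) with h | h
  · rw [min_eq_left h]; linarith
  · rw [min_eq_right h]; linarith

/-- The component of the error on the support that is orthogonal to the range of `U`. -/
lemma tangent_error_bound [DecidableEq r] {U : Matrix t r ℂ}
    (hU : Uᴴ * U = 1) {E : Matrix r p ℂ} (hE : E * Eᴴ = 1) {w : Matrix p ι ℂ}
    {σ b : ℝ} (hw : ∀ z, euclNorm z ^ 2 ≤ σ * euclNorm (w *ᵥ z) ^ 2)
    (hEw : ∀ z, 4 * euclNorm ((E * w) *ᵥ z) ^ 2 ≤ b * euclNorm (w *ᵥ z) ^ 2)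
    (hb0 : 0 ≤ b) (hb1 : b < 1)
    {Δ X D Z : Matrix t p ℂ} {C T : Matrix t ι ℂ} (hX : X = Δ - U * (Uᴴ * Δ))
    (hD : D = X - X * Eᴴ * E) (hT : T = C - U * (Uᴴ * C)) (hZ : Z = Δ - D + C * wᴴ) :
    frobeniusNorm (T * wᴴ) ≤ frobeniusNorm Z / (1 - b) ∧
      frobeniusNorm T ^ 2 ≤ σ * frobeniusNorm (T * wᴴ) ^ 2 := by
  classical
  have hT2 := frobeniusNorm_sq_le_mul_conjTranspose hw T
  refine ⟨?_, hT2⟩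
  obtain ⟨Y, hY⟩ : ∃ Y, Y = T * wᴴ := ⟨_, rfl⟩
  have hUD : Uᴴ * D = 0 := by
    have hUX : Uᴴ * X = 0 := by
      rw [hX, Matrix.mul_sub, ← Matrix.mul_assoc, hU, Matrix.one_mul, sub_self]
    rw [hD, Matrix.mul_sub, Matrix.mul_assoc X, ← Matrix.mul_assoc Uᴴ X, hUX, Matrix.zero_mul,
      sub_self]
  have hZU : Z - U * (Uᴴ * Z) = X - D + Y := by
    rw [hZ, Matrix.mul_add, Matrix.mul_sub, hUD, sub_zero, Matrix.mul_add, hY, hT, Matrix.sub_mul,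
      hX]
    simp only [Matrix.mul_assoc]
    abel
  -- Projecting `Z` off the range of `U` on the left and off that of `Eᴴ` on the right kills the
  -- tangent error and leaves the projection of `T wᴴ`.
  have hYE : Y - Y * Eᴴ * E = (X - D + Y) - (X - D + Y) * Eᴴ * E := by
    have h0 : (X - D) * Eᴴ * E = X - D := by
      have : X - D = X * Eᴴ * E := by rw [hD]; abel
      rw [this, Matrix.mul_assoc _ E, hE, Matrix.mul_one]
    rw [Matrix.add_mul, Matrix.add_mul, h0]
    abel
  have hright : ∀ A : Matrix t p ℂ, frobeniusNorm (A - A * Eᴴ * E) ^ 2 +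
      frobeniusNorm (A * Eᴴ) ^ 2 = frobeniusNorm A ^ 2 := by
    intro A
    have h := frobeniusNorm_sub_proj_sq (P := Eᴴ)
      (by rwa [Matrix.conjTranspose_conjTranspose]) Aᴴ
    rw [← frobeniusNorm_conjTranspose A, ← frobeniusNorm_conjTranspose (A * Eᴴ),
      ← frobeniusNorm_conjTranspose (A - A * Eᴴ * E), ← h]
    simp only [Matrix.conjTranspose_sub, Matrix.conjTranspose_mul,
      Matrix.conjTranspose_conjTranspose]
  have h1 : frobeniusNorm (Y - Y * Eᴴ * E) ^ 2 ≤ frobeniusNorm Z ^ 2 := by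
    have a1 := hright (X - D + Y)
    have a2 := frobeniusNorm_sub_proj_sq hU Z
    rw [← hYE] at a1
    rw [hZU] at a2
    nlinarith [sq_nonneg (frobeniusNorm ((X - D + Y) * Eᴴ)), sq_nonneg (frobeniusNorm (Uᴴ * Z))]
  have h2 : 4 * frobeniusNorm (Y * Eᴴ) ^ 2 ≤ b * frobeniusNorm Y ^ 2 := by
    have e1 : Y * Eᴴ = T * (E * w)ᴴ := by rw [hY, Matrix.conjTranspose_mul, Matrix.mul_assoc]
    rw [e1, hY, ← frobeniusNorm_conjTranspose, ← frobeniusNorm_conjTranspose (T * wᴴ),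
      Matrix.conjTranspose_mul T, Matrix.conjTranspose_mul T, Matrix.conjTranspose_conjTranspose,
      Matrix.conjTranspose_conjTranspose, frobeniusNorm_sq_cols, frobeniusNorm_sq_cols,
      Finset.mul_sum, Finset.mul_sum]
    exact Finset.sum_le_sum fun j _ => hEw _
  have h3 := hright Y
  rw [← hY, le_div_iff₀ (by linarith)]
  refine abs_le_of_sq_le_sq' ?_ (frobeniusNorm_nonneg Z) |>.2
  rw [mul_pow]
  -- So far `(1 - b/4)‖Y‖² ≤ ‖Z‖²`, and `(1 - b)² ≤ 1 - b/4` on `[0, 1]`.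
  nlinarith [sq_nonneg (frobeniusNorm Y), mul_nonneg hb0 (sq_nonneg (frobeniusNorm Y)),
    mul_nonneg (mul_nonneg hb0 (sub_nonneg.mpr hb1.le)) (sq_nonneg (frobeniusNorm Y))]

end Recovery

/-! ### Stable recovery with the support separated -/

section Recovery

variable {t p r ι κ : Type*} [Fintype t] [Fintype p] [Fintype r] [Fintype ι] [Fintype κ]

lemma OpBound.of_cols {A : Matrix t ι ℂ} {l : ℝ} (hl : 0 ≤ l) (h : ∀ j, euclNorm (A.col j) ≤ l) :
    OpBound A (l * Real.sqrt (Fintype.card ι)) := by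
  intro x
  refine (OpBound.frobenius A x).trans (mul_le_mul_of_nonneg_right ?_ (euclNorm_nonneg x))
  rw [mul_comm]
  exact frobeniusNorm_le_of_cols hl h

/-- The lower bound on `w` converts an operator bound into one relative to `‖w z‖`, the form used in
the certificate construction. -/
lemma OpBound.sq_le {A : Matrix t ι ℂ} {w : Matrix p ι ℂ} {l σ a b : ℝ} (ha : 0 ≤ a)
    (hA : OpBound A (l * Real.sqrt (Fintype.card ι)))
    (hw : ∀ z, euclNorm z ^ 2 ≤ σ * euclNorm (w *ᵥ z) ^ 2)
    (hab : a * (l ^ 2 * Fintype.card ι * σ) ≤ b) (z : ι → ℂ) :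
    a * euclNorm (A *ᵥ z) ^ 2 ≤ b * euclNorm (w *ᵥ z) ^ 2 := by
  have h1 := pow_le_pow_left₀ (euclNorm_nonneg _) (hA z) 2
  rw [mul_pow, mul_pow, Real.sq_sqrt (Nat.cast_nonneg _)] at h1
  calc a * euclNorm (A *ᵥ z) ^ 2
      ≤ a * (l ^ 2 * Fintype.card ι * (σ * euclNorm (w *ᵥ z) ^ 2)) := by
        refine mul_le_mul_of_nonneg_left (h1.trans ?_) ha
        exact mul_le_mul_of_nonneg_left (hw z) (by positivity)
    _ = a * (l ^ 2 * Fintype.card ι * σ) * euclNorm (w *ᵥ z) ^ 2 := by ring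
    _ ≤ _ := mul_le_mul_of_nonneg_right hab (sq_nonneg _)

/-- Stable recovery in terms of the columns `w` on the support and the columns `w'` off it. -/
lemma exists_recovery [DecidableEq p] [DecidableEq r] {U : Matrix t r ℂ} (hU : Uᴴ * U = 1)
    {V : Matrix p r ℂ} (hV : Vᴴ * V = 1) {s : r → ℂ} (hs : ∀ i, s i ≠ 0)
    {L₀ : Matrix t p ℂ} (hL₀ : L₀ = U * Matrix.diagonal s * Vᴴ) (C₀ : Matrix t ι ℂ)
    {w : Matrix p ι ℂ} {w' : Matrix p κ ℂ} {M N : Matrix t p ℂ} (hM : M = L₀ + C₀ * wᴴ + N)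
    {η : ℝ} (hN : frobeniusNorm N ≤ η) {σ ψ ε μ l b : ℝ} (hσ : 0 < σ) (hψ1 : ψ < 1) (hε : 0 ≤ ε)
    (hμ : 0 ≤ μ) (hl : 0 < l) (hb : 0 ≤ b)
    (hw : ∀ z, euclNorm z ^ 2 ≤ σ * euclNorm (w *ᵥ z) ^ 2)
    (hlψ : 4 * (l ^ 2 * Fintype.card ι * σ) ≤ ψ)
    (hVw : ∀ j, euclNorm (Vᴴ *ᵥ w.col j) ≤ ε) (hVw' : ∀ j, euclNorm (Vᴴ *ᵥ w'.col j) ≤ ε)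
    (hww' : ∀ j i, ‖(wᴴ *ᵥ w'.col j) i‖ ≤ μ)
    (hsmall : ε + l * (Fintype.card ι * σ * μ) ≤ l / 3) (hw'b : OpBound w' b)
    {L : Matrix t p ℂ} {C₁ : Matrix t ι ℂ} {C₂ : Matrix t κ ℂ}
    (hfeas : frobeniusNorm (M - L - (C₁ * wᴴ + C₂ * w'ᴴ)) ≤ η)
    (hopt : ∀ (L' : Matrix t p ℂ) (C' : Matrix t ι ℂ), frobeniusNorm (M - L' - C' * wᴴ) ≤ η →
      nuclearNorm L + l * (normOneTwo C₁ + normOneTwo C₂) ≤ nuclearNorm L' + l * normOneTwo C')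
    {τ : ℝ} (hτ : τ = 2 * η *
      Real.sqrt (((min (Fintype.card t) (Fintype.card p) : ℕ) : ℝ) + 3 * Fintype.card r)) :
    ∃ (Lt : Matrix t p ℂ) (Ct : Matrix t ι ℂ) (x : ℝ), Lt + Ct * wᴴ = L₀ + C₀ * wᴴ ∧
      U * (Uᴴ * Lt) = Lt ∧ l * frobeniusNorm C₂ ≤ τ ∧ 0 ≤ x ∧
      frobeniusNorm (L - Lt) ≤ 2 * η + b * frobeniusNorm C₂ + x ∧
      frobeniusNorm (C₁ - Ct) ^ 2 ≤ σ * x ^ 2 ∧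
      x ≤ (2 * η + τ + b * frobeniusNorm C₂) / (1 - ψ) := by
  classical
  have hm : (0 : ℝ) ≤ Fintype.card ι := Nat.cast_nonneg _
  have hψ0 : 0 ≤ ψ := le_trans (by positivity) hlψ
  have hinj : ∀ z, w *ᵥ z = 0 → z = 0 := by
    intro z hz
    have := hw z
    rw [hz, euclNorm_zero] at this
    have h0 : euclNorm z ^ 2 = 0 := by nlinarith [sq_nonneg (euclNorm z)]
    exact euclNorm_eq_zero.mp (pow_eq_zero_iff two_ne_zero |>.mp h0)
  have hVwb : OpBound (Vᴴ * w) (ε * Real.sqrt (Fintype.card ι)) := .of_cols hε hVw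
  have hV36 : ∀ z, 36 * euclNorm (Vᴴ *ᵥ w *ᵥ z) ^ 2 ≤ euclNorm (w *ᵥ z) ^ 2 := by
    intro z
    have h3 : ε ≤ l / 3 := by
      have : 0 ≤ l * (Fintype.card ι * σ * μ) := by positivity
      linarith
    have h4 : ε ^ 2 ≤ (l / 3) ^ 2 := pow_le_pow_left₀ hε h3 2
    -- From `ε ≤ l/3` and `4 l² |ι| σ ≤ ψ < 1`: the constant is `9 · 4`.
    have h5 : 36 * (ε ^ 2 * Fintype.card ι * σ) ≤ 1 := by
      have := mul_le_mul_of_nonneg_right h4 (mul_nonneg hm hσ.le)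
      nlinarith
    simpa [Matrix.mulVec_mulVec] using hVwb.sq_le (by norm_num) hw h5 z
  obtain ⟨B, G, S, hG, hS, hGS, hGL, hSC⟩ := exists_oracle_solution L₀ C₀ U hU w hl
  obtain ⟨A, hA⟩ : ∃ A, A = Matrix.diagonal s * Vᴴ - B * wᴴ := ⟨_, rfl⟩
  obtain ⟨L₁, hL₁⟩ : ∃ L₁, L₁ = L₀ - U * B * wᴴ := ⟨_, rfl⟩
  obtain ⟨C', hC'⟩ : ∃ C', C' = C₀ + U * B := ⟨_, rfl⟩
  rw [← hL₁] at hGL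
  rw [← hC'] at hSC
  have hLA : L₁ = U * A := by
    rw [hL₁, hL₀, hA, Matrix.mul_sub, Matrix.mul_assoc, Matrix.mul_assoc]
  have hUL : U * (Uᴴ * L₁) = L₁ := by
    rw [hLA, ← Matrix.mul_assoc Uᴴ, hU, Matrix.one_mul]
  obtain ⟨E, hE⟩ : ∃ E, E = Uᴴ * G := ⟨_, rfl⟩
  have hEb : OpBound E 1 := by
    rw [hE]
    simpa using ((OpBound.of_isometry hU).conjTranspose zero_le_one).mul zero_le_one hG
  obtain ⟨hp1, hp2⟩ := polar_of_reInner_eq_nuclearNorm hG hGL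
  have hEA1 : Eᴴ * A = Aᴴ * E := by
    have e1 : Eᴴ * A = Gᴴ * L₁ := by
      rw [hE, hLA, Matrix.conjTranspose_mul, Matrix.conjTranspose_conjTranspose, Matrix.mul_assoc]
    have e2 : Aᴴ * E = L₁ᴴ * G := by
      rw [hE, hLA, Matrix.conjTranspose_mul, Matrix.mul_assoc]
    rw [e1, e2, hp1]
  have hEA2 : E * Eᴴ * A = A := by
    have e1 : A = Uᴴ * L₁ := by rw [hLA, ← Matrix.mul_assoc, hU, Matrix.one_mul]
    have e2 : E * Eᴴ * A = Uᴴ * (G * Gᴴ * (U * A)) := by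
      rw [hE, Matrix.conjTranspose_mul, Matrix.conjTranspose_conjTranspose]
      simp only [Matrix.mul_assoc]
    rw [e2, ← hLA, hp2, ← e1]
  obtain ⟨hEE, hEY⟩ := polar_factor_properties hV hinj hV36 hs hA hEb hEA1 hEA2
  have hnuc : reInner (U * E) L₁ = nuclearNorm L₁ := by
    rw [reInner_mul_left, hE, reInner_mul_left, Matrix.conjTranspose_conjTranspose, hUL, hGL]
  have hES : E * w = Uᴴ * S := by rw [hE, hGS]
  have hSb : OpBound S (l * Real.sqrt (Fintype.card ι)) := .of_cols hl.le hS
  have hSψ : ∀ z, 4 * euclNorm (S *ᵥ z) ^ 2 ≤ ψ * euclNorm (w *ᵥ z) ^ 2 :=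
    hSb.sq_le (by norm_num) hw hlψ
  have hEψ : ∀ z, 4 * euclNorm ((E * w) *ᵥ z) ^ 2 ≤ ψ * euclNorm (w *ᵥ z) ^ 2 := by
    intro z
    refine le_trans ?_ (hSψ z)
    rw [hES, ← Matrix.mulVec_mulVec]
    have := (OpBound.of_isometry hU).conjTranspose zero_le_one (S *ᵥ z)
    rw [one_mul] at this
    have := pow_le_pow_left₀ (euclNorm_nonneg _) this 2
    linarith
  obtain ⟨Q, hUQ, hQE, hQw, hQb, hQY⟩ := exists_certificate hU hEE hinj hES (fun z =>
    (hSψ z).trans (mul_le_of_le_one_left (sq_nonneg _) hψ1.le))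
  have hoff : ∀ j, euclNorm ((U * E + Q) *ᵥ w'.col j) ≤ l / 2 := fun j =>
    euclNorm_certificate_le hU hES hQw hEY hQY hσ hl (Real.sqrt_nonneg _) hε hμ hw hSb hVwb
      (euclNorm_le_sqrt_card hμ (hww' j)) (hVw' j) (by rwa [Real.sq_sqrt hm])
  obtain ⟨Δ, hΔ⟩ : ∃ Δ, Δ = L - L₁ := ⟨_, rfl⟩
  obtain ⟨C, hC⟩ : ∃ C, C = C₁ - C' := ⟨_, rfl⟩
  obtain ⟨X, hX⟩ : ∃ X, X = Δ - U * (Uᴴ * Δ) := ⟨_, rfl⟩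
  obtain ⟨D, hD⟩ : ∃ D, D = X - X * Eᴴ * E := ⟨_, rfl⟩
  obtain ⟨T, hT⟩ : ∃ T, T = C - U * (Uᴴ * C) := ⟨_, rfl⟩
  obtain ⟨R, hR⟩ : ∃ R, R = Δ + C * wᴴ + C₂ * w'ᴴ := ⟨_, rfl⟩
  have hsum : L₁ + C' * wᴴ = L₀ + C₀ * wᴴ := by
    rw [hL₁, hC', Matrix.add_mul]; abel
  have hMN : M - L₁ - C' * wᴴ = N := by
    rw [sub_sub, hsum, hM]; abel
  have hRle : frobeniusNorm R ≤ 2 * η := by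
    have e : R = N - (M - L - (C₁ * wᴴ + C₂ * w'ᴴ)) := by
      rw [hR, ← hMN, hΔ, hC, Matrix.sub_mul]; abel
    rw [e]
    refine (frobeniusNorm_sub_le _ _).trans ?_
    linarith
  have herr := error_le_of_certificate hU hEE hES hUQ hQE hQw hQb hS hoff hUL hnuc hSC
    (hopt L₁ C' (by rwa [hMN])) (by rw [hX, hΔ]) hD
  rw [← hΔ, ← hC, ← hR] at herr
  have hcert := frobeniusNorm_certificate_sq_le hU hEE hUQ hQE hQb
  have hη : 0 ≤ η := (frobeniusNorm_nonneg N).trans hN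
  have hmain : frobeniusNorm D + l * normOneTwo C₂ ≤ τ := by
    have h1 : 2 * frobeniusNorm (U * E + Q) ≤
        Real.sqrt (((min (Fintype.card t) (Fintype.card p) : ℕ) : ℝ) + 3 * Fintype.card r) := by
      apply Real.le_sqrt_of_sq_le
      rw [mul_pow]
      linarith
    have h2 := mul_le_mul h1 hRle (frobeniusNorm_nonneg R) (Real.sqrt_nonneg _)
    rw [hτ]
    linarith
  have hC₂ : l * frobeniusNorm C₂ ≤ l * normOneTwo C₂ :=
    mul_le_mul_of_nonneg_left (frobeniusNorm_le_normOneTwo C₂) hl.le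
  have hDτ : frobeniusNorm D ≤ τ := by
    have := mul_nonneg hl.le (normOneTwo_nonneg C₂)
    linarith
  have hC₂τ : l * frobeniusNorm C₂ ≤ τ := by
    have := frobeniusNorm_nonneg D
    linarith
  have hC₂w : frobeniusNorm (C₂ * w'ᴴ) ≤ b * frobeniusNorm C₂ :=
    frobeniusNorm_mul_le_right hb (hw'b.conjTranspose hb) C₂
  -- `Z` is what remains of the residual `R` once the two parts already controlled, `D` and `C₂
  -- w'ᴴ`, are removed.
  obtain ⟨hx1, hx2⟩ := tangent_error_bound hU hEE hw hEψ hψ0 hψ1 hX hD hT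
    (Z := R - D - C₂ * w'ᴴ) (by rw [hR]; abel)
  -- The component of the support error along `U` is moved into the low-rank part; this leaves the
  -- signal unchanged and makes the support error exactly `T`.
  refine ⟨L₁ - U * (Uᴴ * C) * wᴴ, C' + U * (Uᴴ * C), frobeniusNorm (T * wᴴ), ?_, ?_, hC₂τ,
    frobeniusNorm_nonneg _, ?_, ?_, ?_⟩
  · rw [← hsum, Matrix.add_mul]; abel
  · rw [Matrix.mul_sub, Matrix.mul_sub, hUL, Matrix.mul_assoc U (Uᴴ * C), ← Matrix.mul_assoc Uᴴ U,
      hU, Matrix.one_mul]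
  · have e : L - (L₁ - U * (Uᴴ * C) * wᴴ) = R - C₂ * w'ᴴ - T * wᴴ := by
      rw [hR, hT, hΔ, Matrix.sub_mul]; abel
    rw [e]
    have h1 := frobeniusNorm_sub_le (R - C₂ * w'ᴴ) (T * wᴴ)
    have h2 := frobeniusNorm_sub_le R (C₂ * w'ᴴ)
    linarith
  · have e : C₁ - (C' + U * (Uᴴ * C)) = T := by rw [hT, hC]; abel
    rw [e]
    exact hx2
  · refine hx1.trans (div_le_div_of_nonneg_right ?_ (by linarith))
    have h1 := frobeniusNorm_sub_le (R - D) (C₂ * w'ᴴ)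
    have h2 := frobeniusNorm_sub_le R D
    linarith

end Recovery

/-! ### Gram matrices of incoherent unit vectors -/

section Gram

variable {p ι : Type*} [Fintype p] [Fintype ι]

/-- A quadratic form of Gershgorin type: unit vectors of coherence at most `μ`. -/
lemma abs_euclNorm_mulVec_sq_sub_le [DecidableEq ι] {w : Matrix p ι ℂ} {μ : ℝ}
    (h1 : ∀ j, euclNorm (w.col j) = 1) (h2 : ∀ i j, i ≠ j → ‖(wᴴ * w) i j‖ ≤ μ) (hμ : 0 ≤ μ)
    (z : ι → ℂ) :
    |euclNorm (w *ᵥ z) ^ 2 - euclNorm z ^ 2| ≤ ((Fintype.card ι : ℝ) - 1) * μ * euclNorm z ^ 2 := by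
  have e : euclNorm (w *ᵥ z) ^ 2 - euclNorm z ^ 2 = reDot z ((wᴴ * w - 1) *ᵥ z) := by
    rw [Matrix.sub_mulVec, reDot_sub_right, Matrix.one_mulVec, reDot_self, euclNorm_mulVec_sq]
  have hentry : ∀ i j, ‖(wᴴ * w - 1 : Matrix ι ι ℂ) i j‖ ≤ μ - if i = j then μ else 0 := by
    intro i j
    by_cases hij : i = j
    · subst hij
      have h0 : (wᴴ * w) i i = 1 := by
        have a1 : (wᴴ * w) i i = ((∑ k, ‖w k i‖ ^ 2 : ℝ) : ℂ) := by
          rw [Matrix.mul_apply, Complex.ofReal_sum]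
          refine Finset.sum_congr rfl fun k _ => ?_
          rw [Matrix.conjTranspose_apply, RCLike.star_def, Complex.conj_mul', Complex.ofReal_pow]
        have a2 := euclNorm_sq (w.col i)
        rw [h1 i] at a2
        have a3 : (∑ k, ‖w k i‖ ^ 2 : ℝ) = 1 := by
          rw [one_pow] at a2
          exact a2.symm
        rw [a1, a3, Complex.ofReal_one]
      simp [h0]
    · simpa [hij] using h2 i j hij
  rw [e]
  calc |reDot z ((wᴴ * w - 1) *ᵥ z)|
      ≤ ‖star z ⬝ᵥ ((wᴴ * w - 1) *ᵥ z)‖ := Complex.abs_re_le_norm _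
    _ ≤ ∑ i, ‖z i‖ * ∑ j, (μ - if i = j then μ else 0) * ‖z j‖ := by
        refine (norm_sum_le _ _).trans (Finset.sum_le_sum fun i _ => ?_)
        rw [norm_mul, Pi.star_apply, norm_star]
        refine mul_le_mul_of_nonneg_left ((norm_sum_le _ _).trans ?_) (norm_nonneg _)
        refine Finset.sum_le_sum fun j _ => ?_
        rw [norm_mul]
        exact mul_le_mul_of_nonneg_right (hentry i j) (norm_nonneg _)
    _ = μ * (∑ i, ‖z i‖) ^ 2 - μ * euclNorm z ^ 2 := by
        have : ∀ i, ‖z i‖ * ∑ j, (μ - if i = j then μ else 0) * ‖z j‖ =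
            μ * (‖z i‖ * ∑ j, ‖z j‖) - μ * ‖z i‖ ^ 2 := by
          intro i
          simp only [sub_mul, Finset.sum_sub_distrib, ite_mul, zero_mul, Finset.sum_ite_eq,
            Finset.mem_univ, if_true, ← Finset.mul_sum]
          ring
        simp only [this, Finset.sum_sub_distrib, ← Finset.mul_sum, ← Finset.sum_mul]
        rw [euclNorm_sq]
        ring
    _ ≤ _ := by
        -- Cauchy-Schwarz on `∑ ‖z i‖` gives the factor `card ι`; the subtracted diagonal lowers it
        -- to `card ι - 1`.
        have := sq_sum_le_card_mul_sum_sq (s := Finset.univ) (f := fun i => ‖z i‖)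
        rw [← euclNorm_sq, Finset.card_univ] at this
        nlinarith

/-- The spectral norm of the inverse Gram matrix bounds vectors by their images. -/
lemma euclNorm_sq_le_of_spectralNorm_inv [DecidableEq ι] {A : Matrix p ι ℂ}
    (hA : ∀ z, A *ᵥ z = 0 → z = 0) {σ : ℝ} (hσ : spectralNorm (Aᴴ * A)⁻¹ ≤ σ) (z : ι → ℂ) :
    euclNorm z ^ 2 ≤ σ * euclNorm (A *ᵥ z) ^ 2 := by
  obtain ⟨J, hJ1, hJ2⟩ := exists_gram_inv hA
  rw [Matrix.inv_eq_left_inv hJ1] at hσ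
  have hJ : ∀ x, euclNorm (J *ᵥ x) ≤ σ * euclNorm x := by
    intro x
    have := Matrix.l2_opNorm_mulVec J (WithLp.toLp 2 x)
    rw [euclNorm_eq_norm, euclNorm_eq_norm]
    exact this.trans (mul_le_mul_of_nonneg_right hσ (norm_nonneg _))
  have hz : (Aᴴ * A) *ᵥ J *ᵥ z = z := by rw [Matrix.mulVec_mulVec, hJ2, Matrix.one_mulVec]
  -- Pairing `A z` with `A J z` keeps the bound linear in `σ`, because `‖A J z‖² = ⟨J z, z⟩`.
  have h1 : euclNorm z ^ 2 ≤ euclNorm (A *ᵥ z) * euclNorm (A *ᵥ J *ᵥ z) := by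
    have e : reDot z z = reDot (A *ᵥ z) (A *ᵥ J *ᵥ z) := by
      rw [reDot_mulVec, Matrix.mulVec_mulVec, hz]
    rw [← reDot_self, e]
    exact reDot_le _ _
  have h2 : euclNorm (A *ᵥ J *ᵥ z) ^ 2 ≤ σ * euclNorm z ^ 2 := by
    rw [euclNorm_mulVec_sq, hz]
    refine (reDot_le _ _).trans ?_
    nlinarith [hJ z, euclNorm_nonneg z]
  rcases (euclNorm_nonneg z).eq_or_lt with h0 | h0
  · have hz0 : z = 0 := euclNorm_eq_zero.mp h0.symm
    simp [hz0, euclNorm_zero]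
  · have h3 : (euclNorm z ^ 2) ^ 2 ≤ euclNorm (A *ᵥ z) ^ 2 * (σ * euclNorm z ^ 2) := by
      refine (pow_le_pow_left₀ (sq_nonneg _) h1 2).trans ?_
      rw [mul_pow]
      exact mul_le_mul_of_nonneg_left h2 (sq_nonneg _)
    have h4 : 0 < euclNorm z ^ 2 := by positivity
    nlinarith

end Gram

/-! ### Splitting a matrix into columns on and off the support -/

section Columns

variable {a c d : Type*} [Fintype a] [Fintype c] [Fintype d] [DecidableEq c]

/-- The submatrix formed by the columns with index outside `I`. -/
def colComplement (A : Matrix a c ℂ) (I : Finset c) : Matrix a {j // j ∉ I} ℂ :=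
  A.submatrix id Subtype.val

/-- Extension by zero columns. -/
def extendCols {I : Finset c} (X : Matrix a I ℂ) : Matrix a c ℂ :=
  Matrix.of fun i j => if h : j ∈ I then X i ⟨j, h⟩ else 0

omit [Fintype a] [Fintype c] in
lemma colSubmatrix_extendCols {I : Finset c} (X : Matrix a I ℂ) :
    colSubmatrix (extendCols X) I = X := by
  ext i j
  simp [colSubmatrix, extendCols]

omit [Fintype a] [Fintype c] in
lemma colComplement_extendCols {I : Finset c} (X : Matrix a I ℂ) :
    colComplement (extendCols X) I = 0 := by
  ext i j
  simp [colComplement, extendCols, j.2]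

omit [Fintype a] [Fintype c] in
lemma projCols_extendCols {I : Finset c} (X : Matrix a I ℂ) :
    projCols I (extendCols X) = extendCols X := by
  ext i j
  by_cases h : j ∈ I <;> simp [projCols, extendCols, h]

omit [Fintype a] [Fintype d] in
lemma sum_eq_sum_mem_add_sum_not_mem {β : Type*} [AddCommMonoid β] (I : Finset c) (f : c → β) :
    ∑ k, f k = ∑ k : I, f k + ∑ k : {j // j ∉ I}, f k := by
  rw [Finset.sum_coe_sort I f, ← Finset.sum_subtype Iᶜ (fun _ => Finset.mem_compl) f,
    Finset.sum_add_sum_compl]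

omit [Fintype a] [Fintype d] in
lemma mul_conjTranspose_split (A : Matrix a c ℂ) (w : Matrix d c ℂ) (I : Finset c) :
    A * wᴴ = colSubmatrix A I * (colSubmatrix w I)ᴴ + colComplement A I * (colComplement w I)ᴴ := by
  ext i j
  simp only [Matrix.add_apply, Matrix.mul_apply]
  exact sum_eq_sum_mem_add_sum_not_mem I (fun k => A i k * wᴴ k j)

lemma normOneTwo_split (A : Matrix a c ℂ) (I : Finset c) :
    normOneTwo A = normOneTwo (colSubmatrix A I) + normOneTwo (colComplement A I) :=
  sum_eq_sum_mem_add_sum_not_mem I (fun k => colNorm A k)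

lemma frobeniusNorm_le_split (A : Matrix a c ℂ) (I : Finset c) :
    frobeniusNorm A ≤ frobeniusNorm (colSubmatrix A I) + frobeniusNorm (colComplement A I) := by
  have h : frobeniusNorm A ^ 2 =
      frobeniusNorm (colSubmatrix A I) ^ 2 + frobeniusNorm (colComplement A I) ^ 2 := by
    rw [frobeniusNorm_sq_cols, frobeniusNorm_sq_cols, frobeniusNorm_sq_cols]
    exact sum_eq_sum_mem_add_sum_not_mem I (fun k => euclNorm (A.col k) ^ 2)
  have h1 := frobeniusNorm_nonneg (colSubmatrix A I)
  have h2 := frobeniusNorm_nonneg (colComplement A I)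
  exact abs_le_of_sq_le_sq' (by nlinarith) (by positivity) |>.2

omit [Fintype a] [DecidableEq c] in
lemma colComplement_colSupport (A : Matrix a c ℂ) : colComplement A (colSupport A) = 0 := by
  ext i j
  have := j.2
  simp only [colSupport, Finset.mem_filter, Finset.mem_univ, true_and, not_exists, not_not] at this
  exact this i

end Columns

/-! ### The parameters `ε`, `μ`, `σ_k` and the range of `λ` -/

section Parameters

variable {p n : ℕ}

lemma norm_gram_le_muParam (W : Matrix (Fin p) (Fin n) ℂ) {i j : Fin n} (hij : i ≠ j) :
    ‖(Wᴴ * W) i j‖ ≤ muParam W :=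
  le_ciSup (f := fun q : {q : Fin n × Fin n // q.1 ≠ q.2} => ‖(Wᴴ * W) q.1.1 q.1.2‖)
    (Set.finite_range _).bddAbove ⟨(i, j), hij⟩

lemma muParam_nonneg (W : Matrix (Fin p) (Fin n) ℂ) : 0 ≤ muParam W :=
  Real.iSup_nonneg fun _ => norm_nonneg _

lemma epsParam_nonneg {r : ℕ} (V : Matrix (Fin p) (Fin r) ℂ) (W : Matrix (Fin p) (Fin n) ℂ) :
    0 ≤ epsParam V W :=
  Real.iSup_nonneg fun _ => Real.sqrt_nonneg _

lemma euclNorm_le_epsParam {r : ℕ} (V : Matrix (Fin p) (Fin r) ℂ) (W : Matrix (Fin p) (Fin n) ℂ)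
    (j : Fin n) : euclNorm (Vᴴ *ᵥ (W.map (starRingEnd ℂ)).col j) ≤ epsParam V W :=
  le_ciSup (f := fun j => colNorm (Vᴴ * W.map (starRingEnd ℂ)) j)
    (Set.finite_range _).bddAbove j

lemma spectralNorm_inv_le_sigmaParam (W : Matrix (Fin p) (Fin n) ℂ) {k : ℕ} {I : Finset (Fin n)}
    (hI : I.card ≤ k) :
    spectralNorm ((colSubmatrix W I)ᴴ * colSubmatrix W I)⁻¹ ≤ sigmaParam W k :=
  le_ciSup (f := fun I : {I : Finset (Fin n) // I.card ≤ k} =>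
    spectralNorm ((colSubmatrix W I.1)ᴴ * colSubmatrix W I.1)⁻¹)
    (Set.finite_range _).bddAbove ⟨I, hI⟩

lemma sigmaParam_mono (W : Matrix (Fin p) (Fin n) ℂ) {k l : ℕ} (h : k ≤ l) :
    sigmaParam W k ≤ sigmaParam W l := by
  have : Nonempty {I : Finset (Fin n) // I.card ≤ k} := ⟨⟨∅, by simp⟩⟩
  exact ciSup_le fun I => spectralNorm_inv_le_sigmaParam W (I.2.trans h)

/-- Serves to exclude `n = 0`: there `lambdaMax` would be `0`, against `λ > 0`. -/
lemma sigmaParam_eq_zero_of_isEmpty [IsEmpty (Fin n)] (W : Matrix (Fin p) (Fin n) ℂ) (k : ℕ) :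
    sigmaParam W k = 0 := by
  have : ∀ I : {I : Finset (Fin n) // I.card ≤ k},
      spectralNorm ((colSubmatrix W I.1)ᴴ * colSubmatrix W I.1)⁻¹ = 0 := by
    intro I
    have h : ((colSubmatrix W I.1)ᴴ * colSubmatrix W I.1)⁻¹ = 0 := by
      ext i
      exact isEmptyElim i.1
    rw [h, spectralNorm]
    exact @norm_zero _ Matrix.instL2OpNormedAddCommGroup.toSeminormedAddCommGroup.toSeminormedAddGroup
  rw [sigmaParam]
  simp only [this, Real.iSup_const_zero]

/-- A family of unit columns with small coherence has a Gram matrix bounded below through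
`sigmaParam`. -/
lemma euclNorm_sq_le_sigmaParam {W : Matrix (Fin p) (Fin n) ℂ} (hW : ∀ j, colNorm W j = 1) {k : ℕ}
    (hμ : k * muParam W < 1) {I : Finset (Fin n)} (hI : I.card ≤ k) (z : I → ℂ) :
    euclNorm z ^ 2 ≤ sigmaParam W k * euclNorm (colSubmatrix W I *ᵥ z) ^ 2 := by
  -- A singular Gram matrix would have the junk inverse `0`, so injectivity must come first; the
  -- Gershgorin bound gives it from `k μ < 1`.
  refine euclNorm_sq_le_of_spectralNorm_inv (fun x hx => ?_)
    (spectralNorm_inv_le_sigmaParam W hI) z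
  have h := abs_euclNorm_mulVec_sq_sub_le (w := colSubmatrix W I) (μ := muParam W)
    (fun j => hW j) (fun i j hij => norm_gram_le_muParam W (Subtype.coe_ne_coe.mpr hij))
    (muParam_nonneg W) x
  rw [hx, euclNorm_zero, Fintype.card_coe] at h
  have h1 : (I.card : ℝ) * muParam W ≤ k * muParam W :=
    mul_le_mul_of_nonneg_right (by exact_mod_cast hI) (muParam_nonneg W)
  have h2 := (abs_le.mp h).1
  have h3 := muParam_nonneg W
  have h4 : euclNorm x ^ 2 ≤ 0 := by
    by_contra hcon
    push Not at hcon
    nlinarith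
  exact euclNorm_eq_zero.mp (pow_eq_zero_iff two_ne_zero |>.mp (le_antisymm h4 (sq_nonneg _)))

/-- A single unit column already forces the bound. It later allows `√σ` to be replaced by `σ`. -/
lemma one_le_sigmaParam {W : Matrix (Fin p) (Fin n) ℂ} (hW : ∀ j, colNorm W j = 1) {k : ℕ}
    (hk : 1 ≤ k) (hμ : k * muParam W < 1) (j : Fin n) : 1 ≤ sigmaParam W k := by
  have h := euclNorm_sq_le_sigmaParam hW hμ (I := {j}) (by simpa using hk)
    (Pi.single ⟨j, Finset.mem_singleton_self j⟩ 1)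
  rw [Matrix.mulVec_single_one] at h
  have h1 : euclNorm ((colSubmatrix W {j}).col ⟨j, Finset.mem_singleton_self j⟩) = 1 := hW j
  have h2 : euclNorm (Pi.single (⟨j, Finset.mem_singleton_self j⟩ : ({j} : Finset (Fin n)))
      (1 : ℂ)) = 1 := by
    rw [← Matrix.one_mulVec (Pi.single _ _), Matrix.mulVec_single_one]
    exact euclNorm_col_of_isometry (by simp) _
  rw [h1, h2] at h
  simpa using h

lemma euclNorm_star {ι : Type*} [Fintype ι] (x : ι → ℂ) : euclNorm (star x) = euclNorm x := by
  simp [euclNorm]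

lemma euclNorm_map_conj_mulVec {m ι : Type*} [Fintype m] [Fintype ι] (A : Matrix m ι ℂ)
    (z : ι → ℂ) : euclNorm (A.map (starRingEnd ℂ) *ᵥ z) = euclNorm (A *ᵥ star z) := by
  rw [← euclNorm_star]
  congr 1
  ext i
  simp [Matrix.mulVec, dotProduct]

lemma norm_map_conj_gram {m ι : Type*} [Fintype m] (A : Matrix m ι ℂ) (i j : ι) :
    ‖((A.map (starRingEnd ℂ))ᴴ * A.map (starRingEnd ℂ)) i j‖ = ‖(Aᴴ * A) i j‖ := by
  rw [← norm_star]
  congr 1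
  simp [Matrix.mul_apply]

end Parameters

lemma isFeasible_iff {t p n : ℕ} (M : Matrix (Fin t) (Fin p) ℂ) (W : Matrix (Fin p) (Fin n) ℂ)
    {η : ℝ} (hη : 0 ≤ η) (L : Matrix (Fin t) (Fin p) ℂ) (C : Matrix (Fin t) (Fin n) ℂ) :
    IsFeasible M W η L C ↔ frobeniusNorm (M - L - C * Wᵀ) ≤ η := by
  rw [frobeniusNorm, Real.sqrt_le_left hη]
  rfl

/-- The consequences of the choice of the regularisation parameter. -/
lemma parameter_bounds {ψ l ε μ σ k D : ℝ} (hψ0 : 0 < ψ) (hψ1 : ψ < 1) (hl : 0 < l) (hε : 0 ≤ ε)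
    (hμ : 0 ≤ μ) (hk : 0 ≤ k) (hσ : 0 ≤ σ) (hD : D = 1 / 2 - (1 + (2 - ψ)⁻¹) * k * σ * μ)
    (hD0 : 0 < D) (hmin : (1 + (2 - ψ)⁻¹) * ε / D ≤ l)
    (hmax : l ≤ 1 / 2 * Real.sqrt (ψ / (k * σ))) :
    0 < k * σ ∧ ε + l * (k * σ * μ) ≤ l / 3 ∧ 4 * (l ^ 2 * (k * σ)) ≤ ψ := by
  have hkσ : 0 < k * σ := by
    -- If `k σ = 0`, the quotient under the root is `ψ / 0 = 0`, and `l ≤ 0` results.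
    by_contra hcon
    have h0 : k * σ = 0 := le_antisymm (not_lt.mp hcon) (mul_nonneg hk hσ)
    rw [h0, div_zero, Real.sqrt_zero, mul_zero] at hmax
    linarith
  refine ⟨hkσ, ?_, ?_⟩
  -- The factor `1 + (2 - ψ)⁻¹` is at least `3/2`, which turns the bound `l/2` into `l/3`.
  · have hb : 1 / 2 ≤ (2 - ψ)⁻¹ := by
      rw [one_div]
      exact inv_anti₀ (by linarith) (by linarith)
    rw [div_le_iff₀ hD0, hD] at hmin
    generalize (2 - ψ)⁻¹ = b at *
    have h0 : 0 ≤ ε + l * (k * σ * μ) := by positivity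
    have h1 : (1 + b) * (ε + l * (k * σ * μ)) ≤ l / 2 := by linarith
    nlinarith
  · have h1 := pow_le_pow_left₀ hl.le hmax 2
    rw [mul_pow, Real.sq_sqrt (by positivity)] at h1
    have h2 := mul_le_mul_of_nonneg_right h1 hkσ.le
    have h3 : (1 / 2) ^ 2 * (ψ / (k * σ)) * (k * σ) = ψ / 4 := by
      rw [mul_assoc, div_mul_cancel₀ _ hkσ.ne']
      ring
    rw [h3] at h2
    linarith

end AttackID

end

/-! ### The main theorem -/

theorem theorem2 {t p n r : ℕ}
    (Lbar : Matrix (Fin t) (Fin p) ℂ) (Cbar : Matrix (Fin t) (Fin n) ℂ)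
    (N M : Matrix (Fin t) (Fin p) ℂ) (W : Matrix (Fin p) (Fin n) ℂ)
    (Ubar : Matrix (Fin t) (Fin r) ℂ) (s : Fin r → ℝ) (Vbar : Matrix (Fin p) (Fin r) ℂ)
    (hSVD : AttackID.IsCompactSVD Lbar Ubar s Vbar)
    (hW : ∀ j, AttackID.colNorm W j = 1)
    (hM : M = Lbar + Cbar * Wᵀ + N)
    (η : ℝ) (hN : AttackID.frobeniusNorm N ≤ η)
    (ψ c : ℝ) (hψ : ψ ∈ Set.Ioo (0 : ℝ) 1) (hc : c ∈ Set.Ioo (0 : ℝ) 1)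
    (hψc : (2 - ψ) * Real.sqrt ψ / (1 - ψ) ≤ Real.sqrt ((1 + c) / (1 - c)))
    (kt : ℕ) (hkt : 1 ≤ kt)
    (hμ : kt * AttackID.muParam W ≤ c)
    (hdenom : 0 < AttackID.lambdaMinDenom W ψ kt)
    (hminmax : AttackID.lambdaMin Vbar W ψ kt ≤ AttackID.lambdaMax W ψ kt)
    (k : ℕ) (hk1 : 1 ≤ k) (hkkt : k ≤ kt) (hCbar : (AttackID.colSupport Cbar).card ≤ k)
    (lam : ℝ) (hlam : lam ∈ Set.Icc (AttackID.lambdaMin Vbar W ψ kt) (AttackID.lambdaMax W ψ kt))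
    (hlam0 : 0 < lam)
    (Lstar : Matrix (Fin t) (Fin p) ℂ) (Cstar : Matrix (Fin t) (Fin n) ℂ)
    (hout : AttackID.IsMethodOutput M W η lam Lstar Cstar) :
    ∃ (Lt : Matrix (Fin t) (Fin p) ℂ) (Ct : Matrix (Fin t) (Fin n) ℂ),
      Lt + Ct * Wᵀ = Lbar + Cbar * Wᵀ ∧
      AttackID.projU Ubar Lt = Lt ∧
      AttackID.projCols (AttackID.colSupport Cbar) Ct = Ct ∧
      AttackID.frobeniusNorm (Lstar - Lt) ≤
        (2 - ψ + (lam + (2 - ψ) * Real.sqrt (1 + ((n : ℝ) - 1) * AttackID.muParam W)) / lam *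
            Real.sqrt ((min t p : ℕ) + 3 * (r : ℝ))) * (2 * η / (1 - ψ)) ∧
      AttackID.frobeniusNorm (Cstar - Ct) ≤
        (1 + ((lam + Real.sqrt (1 + ((n : ℝ) - 1) * AttackID.muParam W)) / lam +
            (1 - ψ) / (lam * AttackID.sigmaParam W k *
              Real.sqrt (1 + ((k : ℝ) - 1) * AttackID.muParam W))) *
            Real.sqrt ((min t p : ℕ) + 3 * (r : ℝ))) *
          (2 * η * AttackID.sigmaParam W k * Real.sqrt (1 + ((k : ℝ) - 1) * AttackID.muParam W) /
            (1 - ψ)) := by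
  open AttackID in
  have hη : 0 ≤ η := (frobeniusNorm_nonneg N).trans hN
  have hμ0 := muParam_nonneg W
  have hε0 := epsParam_nonneg Vbar W
  have hσt0 : 0 ≤ sigmaParam W kt := Real.iSup_nonneg fun _ =>
    @norm_nonneg _ Matrix.instL2OpNormedAddCommGroup.toSeminormedAddCommGroup.toSeminormedAddGroup _
  obtain ⟨hkσ, hsmall, hlψ⟩ := parameter_bounds hψ.1 hψ.2 hlam0 hε0 hμ0 (Nat.cast_nonneg kt) hσt0
    rfl hdenom hlam.1 hlam.2
  have hne : Nonempty (Fin n) := by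
    by_contra hcon
    rw [not_nonempty_iff] at hcon
    rw [sigmaParam_eq_zero_of_isEmpty, mul_zero] at hkσ
    exact lt_irrefl _ hkσ
  obtain ⟨j₀⟩ := hne
  have hn : (1 : ℝ) ≤ n := by exact_mod_cast Nat.one_le_iff_ne_zero.mpr (fun h => by
    subst h; exact j₀.elim0)
  have hkR : (k : ℝ) ≤ kt := by exact_mod_cast hkkt
  have hμk : k * muParam W < 1 :=
    (mul_le_mul_of_nonneg_right hkR hμ0).trans_lt (hμ.trans_lt hc.2)
  have hσ1 : 1 ≤ sigmaParam W k := one_le_sigmaParam hW hk1 hμk j₀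
  have hσσ : sigmaParam W k ≤ sigmaParam W kt := sigmaParam_mono W hkkt
  obtain ⟨I, hI⟩ : ∃ I, I = colSupport Cbar := ⟨_, rfl⟩
  rw [← hI] at hCbar
  -- The conditions on `λ` are stated at `kt`, but the recovery bound is wanted with `σ_k`;
  -- monotonicity of `|I| σ` transfers them.
  have hIσ : (Fintype.card I : ℝ) * sigmaParam W k ≤ kt * sigmaParam W kt := by
    rw [Fintype.card_coe]
    have : (I.card : ℝ) ≤ kt := by exact_mod_cast hCbar.trans hkkt
    exact mul_le_mul this hσσ (by linarith) (Nat.cast_nonneg _)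
  -- Conjugation turns `Wᵀ` into the adjoint `wᴴ`. Norms and coherence are unchanged, and `ε` is
  -- already defined through the conjugate.
  obtain ⟨w, hw⟩ : ∃ w, w = W.map (starRingEnd ℂ) := ⟨_, rfl⟩
  have hwT : Wᵀ = wᴴ := by
    ext i j
    simp [hw]
  have hwcol : ∀ j, euclNorm (w.col j) = 1 := by
    intro j
    rw [← hW j, hw]
    simp [euclNorm, colNorm]
  have hgram : ∀ i j, i ≠ j → ‖(wᴴ * w) i j‖ ≤ muParam W := by
    intro i j hij
    rw [hw, norm_map_conj_gram]
    exact norm_gram_le_muParam W hij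
  obtain ⟨S, hS⟩ : ∃ S, S = Real.sqrt (1 + ((n : ℝ) - 1) * muParam W) := ⟨_, rfl⟩
  obtain ⟨T, hT⟩ : ∃ T, T = Real.sqrt (1 + ((k : ℝ) - 1) * muParam W) := ⟨_, rfl⟩
  have hS0 : 0 ≤ S := hS ▸ Real.sqrt_nonneg _
  have hT1 : 1 ≤ T := by
    rw [hT, Real.one_le_sqrt]
    have : (1 : ℝ) ≤ k := by exact_mod_cast hk1
    nlinarith
  have hw'b : OpBound (colComplement w I) S := by
    intro z
    refine abs_le_of_sq_le_sq' ?_ (mul_nonneg hS0 (euclNorm_nonneg z)) |>.2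
    have h := (abs_le.mp (abs_euclNorm_mulVec_sq_sub_le (w := colComplement w I) (μ := muParam W)
      (fun j => hwcol j) (fun i j hij => hgram i j (fun h => hij (Subtype.ext h))) hμ0 z)).2
    have hcard : (Fintype.card {j // j ∉ I} : ℝ) ≤ n := by
      have := Fintype.card_subtype_le (fun j : Fin n => j ∉ I)
      rw [Fintype.card_fin] at this
      exact_mod_cast this
    rw [mul_pow, hS, Real.sq_sqrt (by nlinarith)]
    have := mul_le_mul_of_nonneg_right (mul_le_mul_of_nonneg_right hcard hμ0)
      (sq_nonneg (euclNorm z))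
    linarith
  have hMsplit : M = Lbar + colSubmatrix Cbar I * (colSubmatrix w I)ᴴ + N := by
    rw [hM, hwT, mul_conjTranspose_split Cbar w I]
    have : colComplement Cbar I = 0 := by rw [hI]; exact colComplement_colSupport Cbar
    rw [this, Matrix.zero_mul, add_zero]
  have hext : ∀ X : Matrix (Fin t) I ℂ, extendCols X * wᴴ = X * (colSubmatrix w I)ᴴ := by
    intro X
    rw [mul_conjTranspose_split _ w I, colSubmatrix_extendCols, colComplement_extendCols,
      Matrix.zero_mul, add_zero]
  obtain ⟨hfeas, hopt⟩ := hout
  rw [isFeasible_iff M W hη, hwT, mul_conjTranspose_split Cstar w I] at hfeas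
  obtain ⟨q, hq⟩ : ∃ q, q = Real.sqrt (((min t p : ℕ) : ℝ) + 3 * (r : ℝ)) := ⟨_, rfl⟩
  obtain ⟨Lt, Ct, x, h1, h2, h3, h4, h5, h6, h7⟩ := exists_recovery hSVD.orthonormal_left
    hSVD.orthonormal_right (s := fun i => (s i : ℂ))
    (fun i => Complex.ofReal_ne_zero.mpr (hSVD.pos i).ne') hSVD.eq (colSubmatrix Cbar I)
    (w' := colComplement w I) hMsplit hN (σ := sigmaParam W k) (ψ := ψ) (ε := epsParam Vbar W)
    (μ := muParam W) (l := lam) (b := S) (by linarith) hψ.2 hε0 hμ0 hlam0 hS0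
    (fun z => by
      have h := euclNorm_sq_le_sigmaParam hW hμk hCbar (star z)
      rw [euclNorm_star, ← euclNorm_map_conj_mulVec] at h
      rw [hw]
      exact h)
    (by
      have := mul_le_mul_of_nonneg_left hIσ (sq_nonneg lam)
      linarith)
    (fun j => hw ▸ euclNorm_le_epsParam Vbar W j) (fun j => hw ▸ euclNorm_le_epsParam Vbar W j)
    (fun j i => hgram i j (fun h => j.2 (h ▸ i.2)))
    (by
      have := mul_le_mul_of_nonneg_left (mul_le_mul_of_nonneg_right hIσ hμ0) hlam0.le
      linarith)
    hw'b hfeas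
    -- Competitors supported on `I` are feasible for the full program after extension by zero
    -- columns, at the same cost.
    (fun L' C' hf => by
      have := hopt L' (extendCols C') (by rwa [isFeasible_iff M W hη, hwT, hext])
      rwa [normOneTwo_split Cstar I, normOneTwo_split (extendCols C') I, colSubmatrix_extendCols,
        colComplement_extendCols, normOneTwo_zero, add_zero] at this)
    (τ := 2 * η * q) (by rw [hq, Fintype.card_fin, Fintype.card_fin, Fintype.card_fin])
  obtain ⟨f, hf⟩ : ∃ f, f = frobeniusNorm (colComplement Cstar I) := ⟨_, rfl⟩
  rw [← hf] at h3 h5 h7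
  have hψ1 : 0 < 1 - ψ := by linarith [hψ.2]
  have hfle : f ≤ 2 * η * q / lam := by
    rw [le_div_iff₀ hlam0]; linarith
  have hSf : S * f ≤ S * (2 * η * q / lam) := mul_le_mul_of_nonneg_left hfle hS0
  have hx : x ≤ (2 * η + 2 * η * q + S * (2 * η * q / lam)) / (1 - ψ) :=
    h7.trans (div_le_div_of_nonneg_right (by linarith) hψ1.le)
  rw [← hS, ← hT, ← hq]
  refine ⟨Lt, extendCols Ct, ?_, ?_, ?_, ?_, ?_⟩
  · rw [hwT, hext, h1, mul_conjTranspose_split Cbar w I]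
    have : colComplement Cbar I = 0 := by rw [hI]; exact colComplement_colSupport Cbar
    rw [this, Matrix.zero_mul, add_zero]
  · rw [projU, Matrix.mul_assoc, h2]
  · rw [← hI, projCols_extendCols]
  · have e : (2 - ψ + (lam + (2 - ψ) * S) / lam * q) * (2 * η / (1 - ψ)) =
        2 * η + S * (2 * η * q / lam) +
          (2 * η + 2 * η * q + S * (2 * η * q / lam)) / (1 - ψ) := by
      field_simp
      ring
    rw [e]
    linarith
  · have hc1 : frobeniusNorm (colSubmatrix (Cstar - extendCols Ct) I) ≤ sigmaParam W k * T * x := by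
      have e : colSubmatrix (Cstar - extendCols Ct) I = colSubmatrix Cstar I - Ct := by
        conv_rhs => rw [← colSubmatrix_extendCols Ct]
        rfl
      rw [e]
      -- The recovery bound has the factor `√σ`; since `σ ≥ 1` and `T ≥ 1` it is at most the stated
      -- factor `σ T`.
      have hσT : sigmaParam W k ≤ (sigmaParam W k * T) ^ 2 := by
        have h0 : sigmaParam W k ≤ sigmaParam W k * T :=
          le_mul_of_one_le_right (by linarith) hT1
        exact h0.trans (le_self_pow₀ (hσ1.trans h0) two_ne_zero)
      refine abs_le_of_sq_le_sq' ?_ (by positivity) |>.2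
      rw [mul_pow]
      exact h6.trans (mul_le_mul_of_nonneg_right hσT (sq_nonneg x))
    have hc2 : frobeniusNorm (colComplement (Cstar - extendCols Ct) I) = f := by
      have e : colComplement (Cstar - extendCols Ct) I =
          colComplement Cstar I - colComplement (extendCols Ct) I := rfl
      rw [e, colComplement_extendCols, sub_zero, hf]
    have hsplit := frobeniusNorm_le_split (Cstar - extendCols Ct) I
    rw [hc2] at hsplit
    have hσT0 : 0 < sigmaParam W k * T := mul_pos (by linarith) (by linarith)
    have hxm := mul_le_mul_of_nonneg_left hx hσT0.le
    have e : (1 + ((lam + S) / lam + (1 - ψ) / (lam * sigmaParam W k * T)) * q) *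
        (2 * η * sigmaParam W k * T / (1 - ψ)) =
        sigmaParam W k * T * ((2 * η + 2 * η * q + S * (2 * η * q / lam)) / (1 - ψ)) +
          2 * η * q / lam := by
      have ha : sigmaParam W k ≠ 0 := by linarith
      have hb : T ≠ 0 := by linarith
      field_simp
      ring
    rw [e]
    linarith
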